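/- Let $R$ be a proper rational function with complex coefficients, of degree $n\ge 1$, in lowest terms, without poles on $\mathbb R$. Set $\mathcal R_*(z):=R(z)\cdot\overline{R(\overline z)}$. Let $z_1,\dots,z_\nu$ be the distinct poles of $\mathcal R_*$ in the upper half-plane and $n_1,\dots,n_\nu$ their multiplicities, where poles are counted without cancellation between the two factors of $\mathcal R_*$: the $z_k$ are the points of the upper half-plane for which $z_k$ or $\overline{z_k}$ is a pole of $R$, and $n_k$ is the sum of the multiplicities of $z_k$ and of $\overline{z_k}$ as poles of $R$ (multiplicity $0$ if not a pole). Then $\sum_{k=1}^\nu n_k=n$; and if the multiplicities of the poles of $\mathcal R_*$ in the upper half-plane, with $\mathcal R_*$ in lowest terms, also sum to $n$, they coincide with the $n_k$. Put $$B_*(z)=\prod_{k=1}^{\nu}\left(\frac{z-z_k}{z-\overline{z_k}}\right)^{n_k},\qquad \mu_*(x)=\sum_{k=1}^{\nu}\frac{n_k\,\mathrm{Im}\,z_k}{|x-\overline{z_k}|^2}\quad(x\in\mathbb R).$$ Let $m\in\mathbb N$, $m\ge1$, and $\varphi\in\mathbb R$. If $\varphi\not\equiv 0\ (\mathrm{mod}\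 2\pi)$, then the equation $B_*^m(z)=e^{i\varphi}$ has exactly $mn$ distinct roots $x_1,\dots,x_{mn}$ in $\mathbb C$, and all of them are real. If $R^m$ is integrable on $\mathbb R$, then $$\int_{\mathbb R}R^m(x)\,dx=\frac{\pi}{m}\sum_{k=1}^{mn}\frac{R^m(x_k)}{\mu_*(x_k)}.\qquad(1)$$ Moreover, $|R|^{2m}$ is integrable on $\mathbb R$ and $$\|R\|_{L^{2m}(\mathbb R)}^{2m}:=\int_{\mathbb R}|R(x)|^{2m}\,dx=\frac{\pi}{m}\sum_{k=1}^{mn}\frac{|R(x_k)|^{2m}}{\mu_*(x_k)}.\qquad(2)$$ If $\varphi\equiv 0\ (\mathrm{mod}\ 2\pi)$, then one of the $mn$ roots is at infinity: $B_*^m(z)\to e^{i\varphi}$ as $|z|\to\infty$, and the equation has exactly $mn-1$ distinct roots in $\mathbb C$, all of them real. Formulas (1) (if $R^m$ is integrable) and (2) (with $|R|^{2m}$ integrable) hold again, the summand of the root at infinity being the limit of $R^m(x)/\mu_*(x)$, respectively of $|R(x)|^{2m}/\mu_*(x)$, as $|x|\to\infty$; these limits exist and are finite. -/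

import Mathlib

open Filter Topology MeasureTheory

/-- The degree of a rational function (written in lowest terms). -/
noncomputable def ratDegree (R : RatFunc ℂ) : ℕ :=
  max R.num.natDegree R.denom.natDegree

/-- A proper rational function: in lowest terms, `deg (numerator) < deg (denominator)`. -/
def IsProperRat (R : RatFunc ℂ) : Prop :=
  R.num.degree < R.denom.degree

/-- The multiplicity of `w` as a pole of `R` (zero if `w` is not a pole). -/
noncomputable def poleOrder (R : RatFunc ℂ) (w : ℂ) : ℕ :=
  R.denom.rootMultiplicity w

/-- The value `R(z)`. -/
noncomputable def ratValue (R : RatFunc ℂ) (z : ℂ) : ℂ :=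
  R.eval (RingHom.id ℂ) z

/-- The rational function `z ↦ conj (R (conj z))`: all coefficients of `R` are conjugated. -/
noncomputable def conjRat (R : RatFunc ℂ) : RatFunc ℂ :=
  algebraMap (Polynomial ℂ) (RatFunc ℂ) (R.num.map (starRingEnd ℂ)) /
    algebraMap (Polynomial ℂ) (RatFunc ℂ) (R.denom.map (starRingEnd ℂ))

/-- The rational function `R_*(z) = R(z) * conj (R (conj z))`. -/
noncomputable def starRat (R : RatFunc ℂ) : RatFunc ℂ :=
  R * conjRat R

/-- For `R = P / Q` in lowest terms, the denominator `Q(z) * conj (Q (conj z))` of `R_*`, before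
any cancellation between the two factors `R(z)` and `conj (R (conj z))`. -/
noncomputable def starDenom (R : RatFunc ℂ) : Polynomial ℂ :=
  R.denom * R.denom.map (starRingEnd ℂ)

/-- The multiplicity `n_w` of the pole `w` of `R_*`, counted without cancellation between the two
factors of `R_*`: the multiplicity of `w` as a pole of `R` plus that of `conj w`. -/
noncomputable def poleMult (R : RatFunc ℂ) (w : ℂ) : ℕ :=
  (starDenom R).rootMultiplicity w

/-- The distinct poles `w = z_k` of `R_*` (without cancellation) in the open upper half-plane. -/
noncomputable def upperPoles (R : RatFunc ℂ) : Finset ℂ :=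
  open Classical in (starDenom R).roots.toFinset.filter (fun w => 0 < w.im)

/-- The Blaschke product `B_*`. At a pole `conj z_k` of `B_*` the value is `0`, so such a point never
solves `B_* ^ m = exp (i φ)`. -/
noncomputable def blaschkeStar (R : RatFunc ℂ) (z : ℂ) : ℂ :=
  ∏ w ∈ upperPoles R, ((z - w) / (z - (starRingEnd ℂ) w)) ^ poleMult R w

/-- The weight `μ_*` on the real line. -/
noncomputable def muStar (R : RatFunc ℂ) (x : ℝ) : ℝ :=
  ∑ w ∈ upperPoles R, (poleMult R w : ℝ) * w.im / ‖(x : ℂ) - (starRingEnd ℂ) w‖ ^ 2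

/-- `z ∈ ℂ` is a (finite) notch: a root of `B_*(z) ^ m = exp (i φ)`. -/
def IsNotch (R : RatFunc ℂ) (m : ℕ) (φ : ℝ) (z : ℂ) : Prop :=
  blaschkeStar R z ^ m = Complex.exp (Complex.I * φ)

/-! ### Behaviour of polynomials at infinity -/

/-! On the real line both integrands have the form `F / (q * p)`. Here `q` has its zeros at the
`z_k` with multiplicities `m * n_k`, `p` has the conjugate zeros, both are monic of degree `M = m *
n`, and `deg F < 2 * M`. Then `B_* ^ m = q / p`, and the roots of the equation are the zeros of `N =
q - c * p` with `c = exp (i φ)`. Off the real axis `|q| ≠ |p|`, so the zeros are real. At such a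
zero `N' = 2i * μ * q ≠ 0`, where `μ = m * μ_*`, so they are simple.

Bezout gives `F = U * p + V * q` with `U`, `V` of degree less than `M`, hence `F / (q * p) = U / q +
V / p`. Let `u`, `v` be their coefficients of order `M - 1`. In partial fractions only simple poles
contribute to the principal value, `πi` times the residue above the axis and `-πi` below, so the
integral is `πi * (u - v)`. Integrability forces `u + v = 0`, and the value is `2πi * u`.

At a node `q = c * p`, so `F / (q * p * μ) = 2i * (U + c * V) / N'`. By Lagrange interpolation the
sum over the nodes is `2i * (u + c * v) / (1 - c) = 2i * u` if `c ≠ 1`. If `c = 1`, the degree of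
`N` drops by one, and the lost term is the limit of the summand at infinity. The carrying lemmas are
`integral_eval_div_upperPoly_mul_lowerPoly`, `sum_eval_div_eval_derivative_mul_leadingCoeff` and
`sum_nodes_mul_leadingCoeff`. -/

theorem tendsto_eval_div_pow_cobounded (P : Polynomial ℂ) {d : ℕ} (hd : P.natDegree ≤ d) :
    Tendsto (fun z : ℂ => P.eval z / z ^ d) (Bornology.cobounded ℂ) (𝓝 (P.coeff d)) := by
  -- `P(z) / z ^ d` is the reflected polynomial at `1 / z`.
  have h1 : Tendsto (fun z : ℂ => (P.reflect d).eval z⁻¹) (Bornology.cobounded ℂ)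
      (𝓝 ((P.reflect d).eval 0)) :=
    ((P.reflect d).continuous.tendsto 0).comp tendsto_inv₀_cobounded
  have h2 : (P.reflect d).eval 0 = P.coeff d := by
    rw [← Polynomial.coeff_zero_eq_eval_zero, Polynomial.coeff_reflect]
    simp [Polynomial.revAt_le]
  rw [h2] at h1
  refine h1.congr' ?_
  filter_upwards [Bornology.eventually_ne_cobounded (0 : ℂ)] with z hz
  let := invertibleOfNonzero hz
  have h3 := Polynomial.eval₂_reflect_mul_pow (RingHom.id ℂ) z d P hd
  rw [invOf_eq_inv] at h3
  rw [eq_div_iff (pow_ne_zero _ hz)]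
  exact h3

theorem tendsto_eval_div_eval_cobounded (P Q : Polynomial ℂ) {d : ℕ} (hP : P.natDegree ≤ d)
    (hQ : Q.natDegree ≤ d) (hQd : Q.coeff d ≠ 0) :
    Tendsto (fun z : ℂ => P.eval z / Q.eval z) (Bornology.cobounded ℂ)
      (𝓝 (P.coeff d / Q.coeff d)) := by
  refine ((tendsto_eval_div_pow_cobounded P hP).div
    (tendsto_eval_div_pow_cobounded Q hQ) hQd).congr' ?_
  filter_upwards [Bornology.eventually_ne_cobounded (0 : ℂ)] with z hz
  exact div_div_div_cancel_right₀ (pow_ne_zero _ hz) _ _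

theorem tendsto_ofReal_cobounded :
    Tendsto (fun x : ℝ => (x : ℂ)) (cocompact ℝ) (Bornology.cobounded ℂ) := by
  rw [Metric.cobounded_eq_cocompact]
  exact Complex.isometry_ofReal.isClosedEmbedding.tendsto_cocompact

theorem tendsto_ofReal_atTop_cobounded :
    Tendsto (fun x : ℝ => (x : ℂ)) atTop (Bornology.cobounded ℂ) :=
  tendsto_ofReal_cobounded.mono_left atTop_le_cocompact

theorem tendsto_ofReal_atBot_cobounded :
    Tendsto (fun x : ℝ => (x : ℂ)) atBot (Bornology.cobounded ℂ) :=
  tendsto_ofReal_cobounded.mono_left atBot_le_cocompact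

/-! ### Integrability of rational functions on the real line -/

theorem continuous_eval_div_ofReal (F D : Polynomial ℂ) (hD : ∀ x : ℝ, D.eval (x : ℂ) ≠ 0) :
    Continuous (fun x : ℝ => F.eval (x : ℂ) / D.eval (x : ℂ)) :=
  (F.continuous.comp Complex.continuous_ofReal).div
    (D.continuous.comp Complex.continuous_ofReal) hD

theorem integrable_eval_div_of_natDegree_add_two_le (F D : Polynomial ℂ)
    (hD : ∀ x : ℝ, D.eval (x : ℂ) ≠ 0) (hdeg : F.natDegree + 2 ≤ D.natDegree) :
    Integrable (fun x : ℝ => F.eval (x : ℂ) / D.eval (x : ℂ)) := by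
  have hD0 : D ≠ 0 := by rintro rfl; simp at hdeg
  -- `F / D = (G / D) * (1 + x ^ 2)⁻¹`, and `G / D` is bounded at infinity by the degree condition.
  set G : Polynomial ℂ := F * (1 + Polynomial.X ^ 2) with hG
  have hGdeg : G.natDegree ≤ D.natDegree := by
    refine (Polynomial.natDegree_mul_le).trans ?_
    have : (1 + Polynomial.X ^ 2 : Polynomial ℂ).natDegree ≤ 2 := by compute_degree
    lia
  have h1 := (tendsto_eval_div_eval_cobounded G D hGdeg le_rfl
    (by simpa using hD0)).comp tendsto_ofReal_cobounded
  refine (continuous_eval_div_ofReal F D hD).locallyIntegrable.integrable_of_isBigO_cocompact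
    (g := fun x : ℝ => (1 + x ^ 2)⁻¹) ?_ (integrable_inv_one_add_sq.integrableAtFilter _)
  refine Asymptotics.IsBigO.trans (g := fun x : ℝ => (G.eval (x : ℂ) / D.eval (x : ℂ)) *
    (((1 + x ^ 2)⁻¹ : ℝ) : ℂ)) ?_ ?_
  · refine Eventually.isBigO (Eventually.of_forall fun x => le_of_eq ?_) |>.trans
      (Asymptotics.isBigO_norm_left.2 (Asymptotics.isBigO_refl _ _))
    have : (1 + (x : ℂ) ^ 2) ≠ 0 := by
      have : (1 + x ^ 2 : ℝ) ≠ 0 := by positivity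
      exact_mod_cast this
    congr 1
    simp only [hG, Polynomial.eval_mul, Polynomial.eval_add, Polynomial.eval_one,
      Polynomial.eval_pow, Polynomial.eval_X]
    push_cast
    field_simp
  · refine (Asymptotics.IsBigO.mul (h1.isBigO_one ℝ) (g₂ := fun x : ℝ => (1 + x ^ 2)⁻¹)
      (Asymptotics.IsBigO.of_norm_left ?_)).congr_right (fun x => one_mul _)
    simp only [Complex.norm_real]
    exact Asymptotics.isBigO_norm_left.2 (Asymptotics.isBigO_refl _ _)

/-- If the coefficient were nonzero, `x * F / D` would tend to some `c ≠ 0`, so `|F / D| ≥ |c| / (2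
* x)` for large `x`, while `1 / x` is not integrable at infinity. -/
theorem coeff_eq_zero_of_integrable_eval_div (F D : Polynomial ℂ)
    (hdeg : F.natDegree + 1 ≤ D.natDegree)
    (hint : Integrable (fun x : ℝ => F.eval (x : ℂ) / D.eval (x : ℂ))) :
    F.coeff (D.natDegree - 1) = 0 := by
  by_contra hne
  have hD0 : D ≠ 0 := by rintro rfl; simp at hdeg
  have hcoeff : (Polynomial.X * F).coeff D.natDegree = F.coeff (D.natDegree - 1) := by
    obtain ⟨e, he⟩ : ∃ e, D.natDegree = e + 1 := ⟨D.natDegree - 1, by lia⟩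
    rw [he, Polynomial.coeff_X_mul]; simp
  have h1 := (tendsto_eval_div_eval_cobounded (Polynomial.X * F) D
    (Polynomial.natDegree_mul_le.trans (by rw [Polynomial.natDegree_X]; lia)) le_rfl
    (by simpa using hD0)).comp tendsto_ofReal_atTop_cobounded
  rw [hcoeff] at h1
  have hc : F.coeff (D.natDegree - 1) / D.coeff D.natDegree ≠ 0 :=
    div_ne_zero hne (by simpa using hD0)
  set c := F.coeff (D.natDegree - 1) / D.coeff D.natDegree
  have hc' : 0 < ‖c‖ := norm_pos_iff.2 hc
  have h2 := h1.norm.eventually (lt_mem_nhds (half_lt_self hc'))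
  obtain ⟨a, ha⟩ := eventually_atTop.1 (h2.and (eventually_gt_atTop 0))
  refine not_integrableOn_Ioi_inv (a := a) ?_
  refine Integrable.mono' (g := fun x : ℝ => 2 / ‖c‖ * ‖F.eval (x : ℂ) / D.eval (x : ℂ)‖)
    ((hint.norm.const_mul _).integrableOn) (by fun_prop) ?_
  refine (ae_restrict_mem measurableSet_Ioi).mono fun x hx => ?_
  obtain ⟨h3, hx0⟩ := ha x (le_of_lt hx)
  simp only [Function.comp_apply, Polynomial.eval_mul, Polynomial.eval_X, mul_div_assoc,
    norm_mul, Complex.norm_real, Real.norm_eq_abs, abs_of_pos hx0] at h3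
  rw [Real.norm_eq_abs, abs_of_pos (inv_pos.2 hx0), inv_le_iff_one_le_mul₀ hx0]
  rw [div_mul_eq_mul_div, div_mul_eq_mul_div, le_div_iff₀ hc']
  nlinarith

/-! ### Principal values of integrals of partial fractions -/

theorem Complex.sub_mem_slitPlane_of_im_ne_zero {w : ℂ} (hw : w.im ≠ 0) (x : ℝ) :
    (x : ℂ) - w ∈ Complex.slitPlane := by
  rw [Complex.mem_slitPlane_iff]
  right
  simpa using hw

theorem ofReal_sub_ne_zero_of_im_ne_zero {w : ℂ} (hw : w.im ≠ 0) (x : ℝ) : (x : ℂ) - w ≠ 0 :=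
  Complex.slitPlane_ne_zero (Complex.sub_mem_slitPlane_of_im_ne_zero hw x)

theorem tendsto_log_add_sub_log (w : ℂ) :
    Tendsto (fun T : ℝ => Complex.log ((T : ℂ) + w) - Real.log T) atTop (𝓝 0) := by
  have h1 : Tendsto (fun T : ℝ => 1 + w * ((T : ℂ))⁻¹) atTop (𝓝 1) := by
    simpa using ((tendsto_inv₀_cobounded.comp tendsto_ofReal_atTop_cobounded).const_mul w).const_add 1
  have h2 := (continuousAt_clog (by simp : (1 : ℂ) ∈ Complex.slitPlane)).tendsto.comp h1
  rw [Complex.log_one] at h2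
  refine h2.congr' ?_
  filter_upwards [eventually_gt_atTop 0,
    h1.eventually_ne (one_ne_zero)] with T hT hne
  have hT' : (T : ℂ) ≠ 0 := by exact_mod_cast hT.ne'
  have h3 : (T : ℂ) + w = (T : ℂ) * (1 + w * (T : ℂ)⁻¹) := by field_simp
  rw [h3, Complex.log_ofReal_mul hT hne]
  simp

theorem integral_one_div_sub {w : ℂ} (hw : w.im ≠ 0) (a b : ℝ) :
    ∫ x in a..b, 1 / ((x : ℂ) - w) = Complex.log (b - w) - Complex.log (a - w) := by
  refine intervalIntegral.integral_eq_sub_of_hasDerivAt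
    (f := fun x : ℝ => Complex.log ((x : ℂ) - w)) (fun x _ => ?_) ?_
  · exact ((Complex.ofRealCLM.hasDerivAt (x := x)).sub_const w).clog_real
      (Complex.sub_mem_slitPlane_of_im_ne_zero hw x)
  · refine Continuous.intervalIntegrable ?_ _ _
    exact continuous_const.div (by fun_prop) (ofReal_sub_ne_zero_of_im_ne_zero hw)

/-- The path `x - w` stays in the lower half-plane, where the principal logarithm is an
antiderivative. At the two ends the `log T` terms cancel, and the jump between `log (-(T + w))` and
`log (T + w)` leaves `πi`. -/
theorem tendsto_integral_one_div_sub_of_pos {w : ℂ} (hw : 0 < w.im) :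
    Tendsto (fun T : ℝ => ∫ x in (-T)..T, 1 / ((x : ℂ) - w)) atTop
      (𝓝 (Real.pi * Complex.I)) := by
  have h := ((tendsto_log_add_sub_log (-w)).sub (tendsto_log_add_sub_log w)).add_const
    (Real.pi * Complex.I)
  rw [sub_zero, zero_add] at h
  refine h.congr fun T => ?_
  have h1 : Complex.log (-((T : ℂ) + w)) = Complex.log ((T : ℂ) + w) - Real.pi * Complex.I := by
    rw [Complex.log, Complex.log, norm_neg,
      Complex.arg_neg_eq_arg_sub_pi_of_im_pos (by simpa using hw)]
    push_cast; ring
  rw [integral_one_div_sub hw.ne', Complex.ofReal_neg, ← neg_add', h1]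
  ring_nf

theorem tendsto_integral_one_div_sub_of_neg {w : ℂ} (hw : w.im < 0) :
    Tendsto (fun T : ℝ => ∫ x in (-T)..T, 1 / ((x : ℂ) - w)) atTop
      (𝓝 (-(Real.pi * Complex.I))) := by
  have h := ((tendsto_log_add_sub_log (-w)).sub (tendsto_log_add_sub_log w)).sub_const
    (Real.pi * Complex.I)
  rw [sub_zero, zero_sub] at h
  refine h.congr fun T => ?_
  have h1 : Complex.log (-((T : ℂ) + w)) = Complex.log ((T : ℂ) + w) + Real.pi * Complex.I := by
    rw [Complex.log, Complex.log, norm_neg,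
      Complex.arg_neg_eq_arg_add_pi_of_im_neg (by simpa using hw)]
    push_cast; ring
  rw [integral_one_div_sub hw.ne, Complex.ofReal_neg, ← neg_add', h1]
  ring_nf

/-- For exponents at least `2` the antiderivative is a negative power of `x - w`, which vanishes at
both ends. -/
theorem tendsto_integral_one_div_sub_pow {w : ℂ} (hw : w.im ≠ 0) (k : ℕ) :
    Tendsto (fun T : ℝ => ∫ x in (-T)..T, 1 / ((x : ℂ) - w) ^ (k + 2)) atTop (𝓝 0) := by
  have hk : (k : ℂ) + 1 ≠ 0 := by exact_mod_cast k.succ_ne_zero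
  have hne := ofReal_sub_ne_zero_of_im_ne_zero hw
  have hint : ∀ T : ℝ, ∫ x in (-T)..T, 1 / ((x : ℂ) - w) ^ (k + 2) =
      -(((T : ℂ) - w) ^ (k + 1))⁻¹ / (k + 1) - -((((-T : ℝ) : ℂ) - w) ^ (k + 1))⁻¹ / (k + 1) := by
    intro T
    refine intervalIntegral.integral_eq_sub_of_hasDerivAt
      (f := fun x : ℝ => -(((x : ℂ) - w) ^ (k + 1))⁻¹ / (k + 1)) (fun x _ => ?_) ?_
    · have h1 : HasDerivAt (fun x : ℝ => (x : ℂ) - w) 1 x :=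
        (Complex.ofRealCLM.hasDerivAt (x := x)).sub_const w
      have h2 := (((h1.pow (k + 1)).inv (pow_ne_zero _ (hne x))).neg).div_const ((k : ℂ) + 1)
      refine h2.congr_deriv ?_
      have := hne x
      simp only [Nat.add_sub_cancel, Nat.cast_add, Nat.cast_one, Pi.pow_apply]
      field_simp
      ring
    · refine Continuous.intervalIntegrable ?_ _ _
      exact continuous_const.div (by fun_prop) fun x => pow_ne_zero _ (hne x)
  have hlim : ∀ l : Filter ℝ, Tendsto (fun x : ℝ => (x : ℂ)) l (Bornology.cobounded ℂ) →
      Tendsto (fun x : ℝ => -(((x : ℂ) - w) ^ (k + 1))⁻¹ / ((k : ℂ) + 1)) l (𝓝 0) := by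
    intro l hl
    have h1 := tendsto_eval_div_eval_cobounded 1 ((Polynomial.X - Polynomial.C w) ^ (k + 1))
      (d := k + 1) (by simp) (by simp) (by
        have := ((Polynomial.monic_X_sub_C w).pow (k + 1)).coeff_natDegree
        rw [Polynomial.natDegree_pow, Polynomial.natDegree_X_sub_C, mul_one] at this
        simp [this])
    have h2 := ((h1.comp hl).neg).div_const ((k : ℂ) + 1)
    rw [Polynomial.coeff_one] at h2
    simpa using h2
  have h3 := (hlim atTop tendsto_ofReal_atTop_cobounded).sub
    ((hlim atBot tendsto_ofReal_atBot_cobounded).comp tendsto_neg_atTop_atBot)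
  rw [sub_zero] at h3
  exact h3.congr fun T => (hint T).symm

theorem exists_sum_div_pow_of_degree_lt {ι : Type*} [DecidableEq ι] (s : Finset ι) (v : ι → ℂ)
    (hv : Set.InjOn v s) (k : ι → ℕ) (U : Polynomial ℂ)
    (hU : U.degree < (∏ i ∈ s, (Polynomial.X - Polynomial.C (v i)) ^ k i).degree) :
    ∃ r : (i : ι) → Fin (k i) → ℂ,
      ∀ z, (∀ i ∈ s, z ≠ v i) →
        U.eval z / (∏ i ∈ s, (Polynomial.X - Polynomial.C (v i)) ^ k i).eval z =
          ∑ i ∈ s, ∑ j : Fin (k i), r i j / (z - v i) ^ (k i - j.1) := by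
  set A := ∏ i ∈ s, (Polynomial.X - Polynomial.C (v i)) ^ k i with hA
  have hAm : A.Monic := Polynomial.monic_prod_of_monic _ _ fun i _ =>
    (Polynomial.monic_X_sub_C _).pow _
  obtain ⟨q, r, hr, hUeq⟩ := Polynomial.eq_quo_mul_prod_pow_add_sum_rem_mul_prod_pow U
    (s := s) (g := fun i => Polynomial.X - Polynomial.C (v i))
    (fun i _ => Polynomial.monic_X_sub_C _) (fun i hi j hj hij =>
      Polynomial.isCoprime_X_sub_C_of_isUnit_sub
        (sub_ne_zero.2 fun h => hij (hv hi hj h)).isUnit) k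
  rw [← hA] at hUeq
  -- Remainders modulo linear factors are constants.
  have hrC : ∀ i ∈ s, ∀ j, r i j = Polynomial.C ((r i j).coeff 0) := fun i hi j =>
    Polynomial.eq_C_of_degree_le_zero (Order.le_of_lt_succ (by
      have := hr i hi j
      rw [Polynomial.degree_X_sub_C] at this
      exact this))
  have hfac : ∀ i ∈ s, A = (Polynomial.X - Polynomial.C (v i)) ^ k i *
      ∏ l ∈ s.erase i, (Polynomial.X - Polynomial.C (v l)) ^ k l := fun i hi =>
    (Finset.mul_prod_erase s _ hi).symm
  have hrest : (∑ i ∈ s, ∑ j, r i j * (Polynomial.X - Polynomial.C (v i)) ^ j.1 *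
      ∏ l ∈ s.erase i, (Polynomial.X - Polynomial.C (v l)) ^ k l).degree < A.degree := by
    have hbot : (⊥ : WithBot ℕ) < A.degree :=
      bot_lt_iff_ne_bot.2 (by rw [Ne, Polynomial.degree_eq_bot]; exact hAm.ne_zero)
    refine (Polynomial.degree_sum_le _ _).trans_lt ((Finset.sup_lt_iff hbot).2 fun i hi => ?_)
    refine (Polynomial.degree_sum_le _ _).trans_lt ((Finset.sup_lt_iff hbot).2 fun j _ => ?_)
    have hE : (∏ l ∈ s.erase i, (Polynomial.X - Polynomial.C (v l)) ^ k l).Monic :=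
      Polynomial.monic_prod_of_monic _ _ fun i _ => (Polynomial.monic_X_sub_C _).pow _
    rw [hfac i hi, Polynomial.degree_mul, Polynomial.degree_mul, Polynomial.degree_mul,
      Polynomial.degree_eq_natDegree hE.ne_zero]
    suffices h : (r i j * (Polynomial.X - Polynomial.C (v i)) ^ j.1).degree <
        ((Polynomial.X - Polynomial.C (v i)) ^ k i).degree by
      rw [Polynomial.degree_mul] at h
      exact WithBot.add_lt_add_right WithBot.coe_ne_bot h
    rw [Polynomial.degree_pow, Polynomial.degree_mul, Polynomial.degree_pow,
      Polynomial.degree_X_sub_C, hrC i hi j]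
    refine (add_le_add_left Polynomial.degree_C_le _).trans_lt ?_
    simp
  -- The polynomial part vanishes: otherwise `q * A` would have degree at least that of `A`, whereas
  -- it is a difference of polynomials of smaller degree.
  have hq : q = 0 := by
    by_contra hq0
    have h1 : (q * A).degree < A.degree := by
      have h2 : q * A = U - _ := eq_sub_of_add_eq hUeq.symm
      rw [h2]
      exact (Polynomial.degree_sub_le _ _).trans_lt (max_lt hU hrest)
    rw [Polynomial.degree_mul, Polynomial.degree_eq_natDegree hq0,
      Polynomial.degree_eq_natDegree hAm.ne_zero] at h1
    norm_cast at h1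
    lia
  refine ⟨fun i j => (r i j).coeff 0, fun z hz => ?_⟩
  rw [hq, zero_mul, zero_add] at hUeq
  conv_lhs => rw [hUeq]
  rw [Polynomial.eval_finsetSum, Finset.sum_div]
  refine Finset.sum_congr rfl fun i hi => ?_
  rw [Polynomial.eval_finsetSum, Finset.sum_div]
  refine Finset.sum_congr rfl fun j _ => ?_
  have hE : (∏ l ∈ s.erase i, (Polynomial.X - Polynomial.C (v l)) ^ k l).eval z ≠ 0 := by
    rw [Polynomial.eval_prod]
    refine Finset.prod_ne_zero_iff.2 fun l hl => ?_
    simpa using fun h => absurd h (sub_ne_zero.2 (hz l (Finset.mem_of_mem_erase hl)))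
  have hzi : z - v i ≠ 0 := sub_ne_zero.2 (hz i hi)
  have hA' := congrArg (Polynomial.eval z) (hfac i hi)
  rw [Polynomial.eval_mul] at hA'
  rw [hA', Polynomial.eval_mul, mul_div_mul_right _ _ hE, Polynomial.eval_mul, hrC i hi j]
  simp only [Polynomial.eval_C, Polynomial.eval_pow, Polynomial.eval_sub, Polynomial.eval_X]
  have : (z - v i) ^ k i = (z - v i) ^ j.1 * (z - v i) ^ (k i - j.1) := by
    rw [← pow_add]; congr 1; have := j.2; lia
  rw [this, mul_comm (_ ^ j.1), ← div_div]
  field_simp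

theorem tendsto_mul_one_div_sub_pow (w : ℂ) (e : ℕ) (he : 1 ≤ e) :
    Tendsto (fun z : ℂ => z * (1 / (z - w) ^ e)) (Bornology.cobounded ℂ)
      (𝓝 (if e = 1 then 1 else 0)) := by
  have hcoeff : ((Polynomial.X - Polynomial.C w) ^ e).coeff e = 1 := by
    have := ((Polynomial.monic_X_sub_C w).pow e).coeff_natDegree
    rwa [Polynomial.natDegree_pow, Polynomial.natDegree_X_sub_C, mul_one] at this
  have h := tendsto_eval_div_eval_cobounded Polynomial.X ((Polynomial.X - Polynomial.C w) ^ e)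
    (d := e) (by simpa using he) (by simp) (by rw [hcoeff]; exact one_ne_zero)
  rw [hcoeff, div_one, Polynomial.coeff_X] at h
  simp only [eq_comm (a := 1)] at h
  refine h.congr fun z => ?_
  simp [div_eq_mul_inv]

/-- Higher-order poles drop out, and every simple-pole term contributes its residue times the common
value `κ`. The sum of the residues is the coefficient of `U` of order `M - 1`. -/
theorem tendsto_integral_eval_div_prod {ι : Type*} [DecidableEq ι] (s : Finset ι) (v : ι → ℂ)
    (hv : Set.InjOn v s) (him : ∀ i ∈ s, (v i).im ≠ 0) (k : ι → ℕ) (κ : ℂ)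
    (hκ : ∀ i ∈ s, Tendsto (fun T : ℝ => ∫ x in (-T)..T, 1 / ((x : ℂ) - v i)) atTop (𝓝 κ))
    (hM : 0 < ∑ i ∈ s, k i) (U : Polynomial ℂ) (hU : U.natDegree < ∑ i ∈ s, k i) :
    Tendsto (fun T : ℝ => ∫ x in (-T)..T, U.eval (x : ℂ) /
      (∏ i ∈ s, (Polynomial.X - Polynomial.C (v i)) ^ k i).eval (x : ℂ)) atTop
      (𝓝 (κ * U.coeff (∑ i ∈ s, k i - 1))) := by
  set A := ∏ i ∈ s, (Polynomial.X - Polynomial.C (v i)) ^ k i with hA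
  have hAm : A.Monic := Polynomial.monic_prod_of_monic _ _ fun i _ =>
    (Polynomial.monic_X_sub_C _).pow _
  have hAd : A.natDegree = ∑ i ∈ s, k i := by
    rw [hA, Polynomial.natDegree_prod_of_monic _ _ fun i _ => (Polynomial.monic_X_sub_C _).pow _]
    simp
  set M := ∑ i ∈ s, k i
  have hne : ∀ (x : ℝ), ∀ i ∈ s, (x : ℂ) ≠ v i := fun x i hi h => him i hi (by simp [← h])
  obtain ⟨r, hr⟩ := exists_sum_div_pow_of_degree_lt s v hv k U
    (Polynomial.degree_lt_degree (by rwa [← hA, hAd]))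
  have hexp : ∀ (i : ι) (j : Fin (k i)), 1 ≤ k i - j.1 := fun i j => by have := j.2; lia
  -- Two computations of the limit of `x * U / A` at infinity: by leading coefficients, and term by
  -- term in partial fractions.
  have hres : U.coeff (M - 1) =
      ∑ i ∈ s, ∑ j : Fin (k i), r i j * (if k i - j.1 = 1 then 1 else 0) := by
    have h1 := tendsto_eval_div_eval_cobounded (Polynomial.X * U) A (d := M)
      (Polynomial.natDegree_mul_le.trans (by rw [Polynomial.natDegree_X]; lia)) hAd.le
      (by rw [← hAd, hAm.coeff_natDegree]; exact one_ne_zero)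
    have hc : A.coeff M = 1 := by rw [← hAd, hAm.coeff_natDegree]
    obtain ⟨e, he⟩ : ∃ e, M = e + 1 := ⟨M - 1, by lia⟩
    rw [hc, div_one, he, Polynomial.coeff_X_mul] at h1
    rw [he, Nat.add_sub_cancel]
    refine tendsto_nhds_unique (h1.comp tendsto_ofReal_atTop_cobounded) ?_
    have h2 : Tendsto (fun z : ℂ => ∑ i ∈ s, ∑ j : Fin (k i),
        r i j * (z * (1 / (z - v i) ^ (k i - j.1)))) (Bornology.cobounded ℂ)
        (𝓝 (∑ i ∈ s, ∑ j : Fin (k i), r i j * (if k i - j.1 = 1 then 1 else 0))) :=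
      tendsto_finsetSum _ fun i _ => tendsto_finsetSum _ fun j _ =>
        (tendsto_mul_one_div_sub_pow (v i) _ (hexp i j)).const_mul _
    refine (h2.comp tendsto_ofReal_atTop_cobounded).congr fun x => ?_
    simp only [Function.comp_apply, Polynomial.eval_mul, Polynomial.eval_X, mul_div_assoc]
    rw [hr _ (hne x), Finset.mul_sum]
    refine Finset.sum_congr rfl fun i _ => ?_
    rw [Finset.mul_sum]
    exact Finset.sum_congr rfl fun j _ => by ring
  have hpv : ∀ i ∈ s, ∀ j : Fin (k i),
      Tendsto (fun T : ℝ => ∫ x in (-T)..T, 1 / ((x : ℂ) - v i) ^ (k i - j.1)) atTop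
        (𝓝 (κ * (if k i - j.1 = 1 then 1 else 0))) := by
    intro i hi j
    split_ifs with h
    · simpa [h] using hκ i hi
    · obtain ⟨e, he⟩ : ∃ e, k i - j.1 = e + 2 := ⟨k i - j.1 - 2, by have := hexp i j; lia⟩
      rw [he, mul_zero]
      exact tendsto_integral_one_div_sub_pow (him i hi) e
  have hcont : ∀ i ∈ s, ∀ j : Fin (k i),
      Continuous fun x : ℝ => 1 / ((x : ℂ) - v i) ^ (k i - j.1) := fun i hi j =>
    continuous_const.div (by fun_prop) fun x => pow_ne_zero _ (sub_ne_zero.2 (hne x i hi))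
  have hlim : Tendsto (fun T : ℝ => ∑ i ∈ s, ∑ j : Fin (k i),
      r i j * ∫ x in (-T)..T, 1 / ((x : ℂ) - v i) ^ (k i - j.1)) atTop
      (𝓝 (∑ i ∈ s, ∑ j : Fin (k i), r i j * (κ * (if k i - j.1 = 1 then 1 else 0)))) :=
    tendsto_finsetSum _ fun i hi => tendsto_finsetSum _ fun j _ => (hpv i hi j).const_mul _
  have hval : κ * U.coeff (M - 1) =
      ∑ i ∈ s, ∑ j : Fin (k i), r i j * (κ * (if k i - j.1 = 1 then 1 else 0)) := by
    rw [hres, Finset.mul_sum]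
    refine Finset.sum_congr rfl fun i _ => ?_
    rw [Finset.mul_sum]
    exact Finset.sum_congr rfl fun j _ => by ring
  rw [hval]
  refine hlim.congr fun T => ?_
  rw [intervalIntegral.integral_congr (g := fun x : ℝ => ∑ i ∈ s, ∑ j : Fin (k i),
    r i j * (1 / ((x : ℂ) - v i) ^ (k i - j.1))) fun x _ => by
      simp only [mul_one_div]; exact hr _ (hne x)]
  rw [intervalIntegral.integral_finsetSum fun i hi => Continuous.intervalIntegrable
    (continuous_finsetSum _ fun j _ => (hcont i hi j).const_mul (r i j)) _ _]
  refine Finset.sum_congr rfl fun i hi => ?_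
  rw [intervalIntegral.integral_finsetSum fun j _ =>
    Continuous.intervalIntegrable ((hcont i hi j).const_mul (r i j)) _ _]
  exact Finset.sum_congr rfl fun j _ => (intervalIntegral.integral_const_mul _ _).symm

/-! ### The polynomials with conjugate families of zeros -/

section ConjugateZeros

variable {s : Finset ℂ} {k : ℂ → ℕ}

/-- The monic polynomial with zeros `w ∈ s` of multiplicities `k w`. -/
noncomputable def upperPoly (s : Finset ℂ) (k : ℂ → ℕ) : Polynomial ℂ :=
  ∏ w ∈ s, (Polynomial.X - Polynomial.C w) ^ k w

/-- The monic polynomial with zeros `conj w`, `w ∈ s`, of multiplicities `k w`. -/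
noncomputable def lowerPoly (s : Finset ℂ) (k : ℂ → ℕ) : Polynomial ℂ :=
  ∏ w ∈ s, (Polynomial.X - Polynomial.C ((starRingEnd ℂ) w)) ^ k w


theorem upperPoly_monic : (upperPoly s k).Monic :=
  Polynomial.monic_prod_of_monic _ _ fun _ _ => (Polynomial.monic_X_sub_C _).pow _

theorem lowerPoly_monic : (lowerPoly s k).Monic :=
  Polynomial.monic_prod_of_monic _ _ fun _ _ => (Polynomial.monic_X_sub_C _).pow _

theorem natDegree_upperPoly : (upperPoly s k).natDegree = ∑ w ∈ s, k w := by
  rw [upperPoly, Polynomial.natDegree_prod_of_monic _ _ fun i _ =>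
    (Polynomial.monic_X_sub_C _).pow _]
  simp

theorem natDegree_lowerPoly : (lowerPoly s k).natDegree = ∑ w ∈ s, k w := by
  rw [lowerPoly, Polynomial.natDegree_prod_of_monic _ _ fun i _ =>
    (Polynomial.monic_X_sub_C _).pow _]
  simp

theorem eval_upperPoly (z : ℂ) : (upperPoly s k).eval z = ∏ w ∈ s, (z - w) ^ k w := by
  simp [upperPoly, Polynomial.eval_prod]

theorem eval_lowerPoly (z : ℂ) :
    (lowerPoly s k).eval z = ∏ w ∈ s, (z - (starRingEnd ℂ) w) ^ k w := by
  simp [lowerPoly, Polynomial.eval_prod]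

theorem eval_upperPoly_ne_zero (hs : ∀ w ∈ s, 0 < w.im) {z : ℂ} (hz : z.im ≤ 0) :
    (upperPoly s k).eval z ≠ 0 := by
  rw [eval_upperPoly]
  refine Finset.prod_ne_zero_iff.2 fun w hw => pow_ne_zero _ (sub_ne_zero.2 ?_)
  rintro rfl
  exact absurd (hs _ hw) (not_lt.2 hz)

theorem eval_lowerPoly_ne_zero (hs : ∀ w ∈ s, 0 < w.im) {z : ℂ} (hz : 0 ≤ z.im) :
    (lowerPoly s k).eval z ≠ 0 := by
  rw [eval_lowerPoly]
  refine Finset.prod_ne_zero_iff.2 fun w hw => pow_ne_zero _ (sub_ne_zero.2 ?_)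
  rintro rfl
  have := hs _ hw
  rw [Complex.conj_im] at hz
  linarith

theorem upperPoly_mul_lowerPoly_eval_ne_zero (hs : ∀ w ∈ s, 0 < w.im) (x : ℝ) :
    (upperPoly s k * lowerPoly s k).eval (x : ℂ) ≠ 0 := by
  rw [Polynomial.eval_mul]
  exact mul_ne_zero (eval_upperPoly_ne_zero hs (by simp)) (eval_lowerPoly_ne_zero hs (by simp))

theorem natDegree_upperPoly_mul_lowerPoly :
    (upperPoly s k * lowerPoly s k).natDegree = 2 * ∑ w ∈ s, k w := by
  rw [upperPoly_monic.natDegree_mul lowerPoly_monic, natDegree_upperPoly, natDegree_lowerPoly,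
    two_mul]

theorem isCoprime_upperPoly_lowerPoly (hs : ∀ w ∈ s, 0 < w.im) :
    IsCoprime (upperPoly s k) (lowerPoly s k) := by
  refine IsCoprime.prod_left fun w hw => IsCoprime.prod_right fun w' hw' => ?_
  refine IsCoprime.pow (Polynomial.isCoprime_X_sub_C_of_isUnit_sub
    (sub_ne_zero.2 fun h => ?_).isUnit)
  have h1 := congrArg Complex.im h
  rw [Complex.conj_im] at h1
  have := hs w hw
  have := hs w' hw'
  linarith

/-- A Bezout relation `a * q + b * p = 1` is multiplied by `F`, and `F * b` is reduced modulo `q` to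
make `U` small. The bound on `V` is then automatic. -/
theorem exists_bezout_upperPoly_lowerPoly (hs : ∀ w ∈ s, 0 < w.im) (hM : 0 < ∑ w ∈ s, k w)
    (F : Polynomial ℂ) (hF : F.natDegree < 2 * ∑ w ∈ s, k w) :
    ∃ U V : Polynomial ℂ, U.natDegree < ∑ w ∈ s, k w ∧ V.natDegree < ∑ w ∈ s, k w ∧
      F = U * lowerPoly s k + V * upperPoly s k := by
  obtain ⟨a, b, hab⟩ := isCoprime_upperPoly_lowerPoly (k := k) hs
  have hq := upperPoly_monic (s := s) (k := k)
  have hqd := natDegree_upperPoly (s := s) (k := k)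
  have hpd := natDegree_lowerPoly (s := s) (k := k)
  set q := upperPoly s k
  set p := lowerPoly s k
  have hUd : ((F * b) %ₘ q).natDegree < ∑ w ∈ s, k w := by
    rw [← hqd]
    exact Polynomial.natDegree_modByMonic_lt _ hq fun h => by rw [h] at hqd; simp at hqd; lia
  refine ⟨(F * b) %ₘ q, F * a + ((F * b) /ₘ q) * p, hUd, ?_, ?_⟩
  · have hFeq : F = (F * b) %ₘ q * p + (F * a + ((F * b) /ₘ q) * p) * q := by
      have := Polynomial.modByMonic_add_div (F * b) q
      linear_combination (-F) * hab - p * this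
    -- `V * q = F - U * p` has degree less than `2 * M`, and `q` is monic of degree `M`.
    set V := F * a + ((F * b) /ₘ q) * p
    by_contra hV
    push Not at hV
    have hV0 : V ≠ 0 := by rintro h; rw [h, Polynomial.natDegree_zero] at hV; lia
    have h1 : (V * q).natDegree = V.natDegree + ∑ w ∈ s, k w := by
      rw [mul_comm, hq.natDegree_mul' hV0, hqd, add_comm]
    have h2 : V * q = F - (F * b) %ₘ q * p := by linear_combination -hFeq
    have h3 : (V * q).natDegree < 2 * ∑ w ∈ s, k w := by
      rw [h2]
      refine (Polynomial.natDegree_sub_le _ _).trans_lt (max_lt hF ?_)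
      refine Polynomial.natDegree_mul_le.trans_lt ?_
      lia
    lia
  · have := Polynomial.modByMonic_add_div (F * b) q
    linear_combination (-F) * hab - p * this

theorem coeff_mul_monic_add {U p : Polynomial ℂ} {M : ℕ} (hM : 0 < M) (hU : U.natDegree < M)
    (hp : p.Monic) (hpd : p.natDegree = M) : (U * p).coeff (2 * M - 1) = U.coeff (M - 1) := by
  have h := Polynomial.coeff_mul_add_eq_of_natDegree_le (Nat.le_sub_one_of_lt hU) hpd.le
  have h1 : p.coeff M = 1 := by rw [← hpd, hp.coeff_natDegree]
  rw [h1, mul_one] at h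
  rw [← h]
  congr 1
  lia

/-- The integral of a rational function with denominator `q * p`, where `q` has its zeros in the
upper half-plane and `p` has the conjugate zeros. -/
theorem integral_eval_div_upperPoly_mul_lowerPoly (hs : ∀ w ∈ s, 0 < w.im)
    (hM : 0 < ∑ w ∈ s, k w) {U V : Polynomial ℂ} (hU : U.natDegree < ∑ w ∈ s, k w)
    (hV : V.natDegree < ∑ w ∈ s, k w)
    (hint : Integrable (fun x : ℝ => (U * lowerPoly s k + V * upperPoly s k).eval (x : ℂ) /
      (upperPoly s k * lowerPoly s k).eval (x : ℂ))) :
    U.coeff (∑ w ∈ s, k w - 1) + V.coeff (∑ w ∈ s, k w - 1) = 0 ∧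
    ∫ x : ℝ, (U * lowerPoly s k + V * upperPoly s k).eval (x : ℂ) /
      (upperPoly s k * lowerPoly s k).eval (x : ℂ) =
        2 * Real.pi * Complex.I * U.coeff (∑ w ∈ s, k w - 1) := by
  have hq0 : ∀ x : ℝ, (upperPoly s k).eval (x : ℂ) ≠ 0 := fun x =>
    eval_upperPoly_ne_zero hs (by simp)
  have hp0 : ∀ x : ℝ, (lowerPoly s k).eval (x : ℂ) ≠ 0 := fun x =>
    eval_lowerPoly_ne_zero hs (by simp)
  -- Integrability kills the coefficient of order `2 * M - 1` of the numerator, which is `u + v`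
  -- because `p` and `q` are monic.
  have hsum : U.coeff (∑ w ∈ s, k w - 1) + V.coeff (∑ w ∈ s, k w - 1) = 0 := by
    have h := coeff_eq_zero_of_integrable_eval_div _ _ (by
      rw [natDegree_upperPoly_mul_lowerPoly]
      refine Nat.succ_le_of_lt ((Polynomial.natDegree_add_le _ _).trans_lt (max_lt ?_ ?_)) <;>
      refine Polynomial.natDegree_mul_le.trans_lt ?_
      · rw [natDegree_lowerPoly]; lia
      · rw [natDegree_upperPoly]; lia) hint
    rwa [natDegree_upperPoly_mul_lowerPoly, Polynomial.coeff_add,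
      coeff_mul_monic_add hM hU lowerPoly_monic natDegree_lowerPoly,
      coeff_mul_monic_add hM hV upperPoly_monic natDegree_upperPoly] at h
  refine ⟨hsum, ?_⟩
  have h1 := tendsto_integral_eval_div_prod s id Function.injective_id.injOn
    (fun w hw => (hs w hw).ne') k _
    (fun w hw => tendsto_integral_one_div_sub_of_pos (hs w hw)) hM U hU
  have h2 := tendsto_integral_eval_div_prod s (starRingEnd ℂ) (starRingEnd ℂ).injective.injOn
    (fun w hw => by simpa using (hs w hw).ne') k _
    (fun w hw => tendsto_integral_one_div_sub_of_neg (by simpa using hs w hw)) hM V hV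
  have h3 := intervalIntegral_tendsto_integral hint tendsto_neg_atTop_atBot tendsto_id
  refine tendsto_nhds_unique h3 ?_
  have h4 := h1.add h2
  have h5 : (Real.pi * Complex.I) * U.coeff (∑ w ∈ s, k w - 1) +
      -(Real.pi * Complex.I) * V.coeff (∑ w ∈ s, k w - 1) =
      2 * Real.pi * Complex.I * U.coeff (∑ w ∈ s, k w - 1) := by
    linear_combination -(Real.pi * Complex.I) * hsum
  rw [h5] at h4
  refine h4.congr fun T => ?_
  change (∫ x in (-T)..T, U.eval (x : ℂ) / (upperPoly s k).eval (x : ℂ)) +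
    ∫ x in (-T)..T, V.eval (x : ℂ) / (lowerPoly s k).eval (x : ℂ) = _
  rw [← intervalIntegral.integral_add
    ((continuous_eval_div_ofReal U _ hq0).intervalIntegrable _ _)
    ((continuous_eval_div_ofReal V _ hp0).intervalIntegrable _ _)]
  refine intervalIntegral.integral_congr fun x _ => ?_
  change U.eval (x : ℂ) / (upperPoly s k).eval (x : ℂ) +
    V.eval (x : ℂ) / (lowerPoly s k).eval (x : ℂ) = _
  rw [Polynomial.eval_add, Polynomial.eval_mul, Polynomial.eval_mul, Polynomial.eval_mul]
  have := hq0 x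
  have := hp0 x
  field_simp

/-! ### Lagrange summation -/

/-- Lagrange interpolation at the simple zeros of `N` expresses the coefficient of `W` of order `deg
N - 1`. The factor `X` avoids the truncated subtraction, so that a constant `N`, without zeros, is
included. -/
theorem sum_eval_div_eval_derivative_mul_leadingCoeff (N W : Polynomial ℂ) (hN : N.roots.Nodup)
    (hW : W.degree < (N.natDegree : WithBot ℕ)) :
    (∑ z ∈ N.roots.toFinset, W.eval z / N.derivative.eval z) * N.leadingCoeff =
      (Polynomial.X * W).coeff N.natDegree := by
  have hcard : N.roots.card = N.natDegree := IsAlgClosed.card_roots_eq_natDegree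
  have hcard' : N.roots.toFinset.card = N.natDegree := by
    rw [Multiset.toFinset_card_of_nodup hN, hcard]
  rcases Nat.eq_zero_or_pos N.natDegree with h0 | hpos
  · rw [h0] at hcard' ⊢
    rw [Finset.card_eq_zero.1 hcard']
    simp
  · have hN0 : N.leadingCoeff ≠ 0 := by
      rw [Polynomial.leadingCoeff_ne_zero]
      rintro rfl
      simp at hpos
    have hfac : N = Polynomial.C N.leadingCoeff * Lagrange.nodal N.roots.toFinset id := by
      conv_lhs => rw [← Polynomial.C_leadingCoeff_mul_prod_multiset_X_sub_C hcard]
      rw [Lagrange.nodal_eq, Finset.prod, Multiset.toFinset_val, hN.dedup]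
      rfl
    have hco := Lagrange.coeff_eq_sum (s := N.roots.toFinset) (v := id)
      Function.injective_id.injOn (P := W) (by rwa [hcard'])
    obtain ⟨e, he⟩ : ∃ e, N.natDegree = e + 1 := ⟨N.natDegree - 1, by lia⟩
    rw [hcard', he, Nat.add_sub_cancel] at hco
    rw [he, Polynomial.coeff_X_mul, hco, Finset.sum_mul]
    refine Finset.sum_congr rfl fun z hz => ?_
    have hder : N.derivative.eval z =
        N.leadingCoeff * ∏ j ∈ N.roots.toFinset.erase z, (z - j) := by
      conv_lhs => rw [hfac]
      rw [Polynomial.derivative_C_mul, Polynomial.eval_C_mul]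
      have := Lagrange.eval_nodal_derivative_eval_node_eq (v := id) hz
      rw [id_eq] at this
      rw [this, Lagrange.eval_nodal]
      rfl
    rw [hder]
    simp only [id_eq]
    rw [mul_comm N.leadingCoeff, ← div_div, div_mul_cancel₀ _ hN0]

/-! ### The weight -/

/-- The weight `∑ k w * Im w / |x - conj w| ^ 2` attached to zeros `w ∈ s` of multiplicities
`k w`. -/
noncomputable def poissonWeight (s : Finset ℂ) (k : ℂ → ℕ) (x : ℝ) : ℝ :=
  ∑ w ∈ s, (k w : ℝ) * w.im / ‖(x : ℂ) - (starRingEnd ℂ) w‖ ^ 2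

theorem eval_derivative_prod_X_sub_C_pow {ι : Type*} (s : Finset ι) (v : ι → ℂ) (k : ι → ℕ)
    (z : ℂ) (hz : ∀ i ∈ s, z ≠ v i) :
    (∏ i ∈ s, (Polynomial.X - Polynomial.C (v i)) ^ k i).derivative.eval z =
      (∏ i ∈ s, (Polynomial.X - Polynomial.C (v i)) ^ k i).eval z *
        ∑ i ∈ s, (k i : ℂ) / (z - v i) := by
  classical
  induction s using Finset.induction_on with
  | empty => simp
  | insert a s ha ih =>
    have hza : z - v a ≠ 0 := sub_ne_zero.2 (hz a (Finset.mem_insert_self _ _))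
    rw [Finset.prod_insert ha, Finset.sum_insert ha, Polynomial.derivative_mul,
      Polynomial.eval_add, Polynomial.eval_mul, Polynomial.eval_mul,
      ih fun i hi => hz i (Finset.mem_insert_of_mem hi), Polynomial.derivative_X_sub_C_pow,
      Polynomial.eval_mul]
    have hpow : ((Polynomial.C (k a : ℂ)) *
        (Polynomial.X - Polynomial.C (v a)) ^ (k a - 1)).eval z =
        (z - v a) ^ k a * ((k a : ℂ) / (z - v a)) := by
      rcases Nat.eq_zero_or_pos (k a) with h | h
      · simp [h]
      · obtain ⟨e, he⟩ : ∃ e, k a = e + 1 := ⟨k a - 1, by lia⟩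
        simp only [he, Nat.add_sub_cancel, Polynomial.eval_mul, Polynomial.eval_C,
          Polynomial.eval_pow, Polynomial.eval_sub, Polynomial.eval_X]
        field_simp
        ring
    rw [Polynomial.eval_mul] at hpow
    rw [hpow]
    simp only [Polynomial.eval_mul]
    simp only [Polynomial.eval_pow, Polynomial.eval_sub, Polynomial.eval_X, Polynomial.eval_C]
    ring

theorem one_div_sub_sub_one_div_sub_conj {w : ℂ} (hw : w.im ≠ 0) (x : ℝ) :
    1 / ((x : ℂ) - w) - 1 / ((x : ℂ) - (starRingEnd ℂ) w) =
      2 * Complex.I * ((w.im / ‖(x : ℂ) - (starRingEnd ℂ) w‖ ^ 2 : ℝ) : ℂ) := by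
  have h1 := ofReal_sub_ne_zero_of_im_ne_zero hw x
  have h2 : (x : ℂ) - (starRingEnd ℂ) w ≠ 0 :=
    ofReal_sub_ne_zero_of_im_ne_zero (by simpa using hw) x
  have h3 : ((x : ℂ) - w) * ((x : ℂ) - (starRingEnd ℂ) w) =
      ((‖(x : ℂ) - (starRingEnd ℂ) w‖ : ℝ) : ℂ) ^ 2 := by
    rw [← Complex.conj_mul']
    simp
  have h4 : w - (starRingEnd ℂ) w = 2 * w.im * Complex.I := by
    rw [Complex.sub_conj]; push_cast; ring
  rw [div_sub_div _ _ h1 h2, h3]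
  push_cast
  rw [show 1 * ((x : ℂ) - (starRingEnd ℂ) w) - ((x : ℂ) - w) * 1 = w - (starRingEnd ℂ) w by ring,
    h4]
  ring

/-- On the real line the logarithmic derivative of `q / p` is `2i` times the weight. This is how the
weight enters `N'`. -/
theorem sum_div_sub_sub_sum_div_sub_conj (hs : ∀ w ∈ s, 0 < w.im) (x : ℝ) :
    ∑ w ∈ s, (k w : ℂ) / ((x : ℂ) - w) - ∑ w ∈ s, (k w : ℂ) / ((x : ℂ) - (starRingEnd ℂ) w) =
      2 * Complex.I * poissonWeight s k x := by
  rw [← Finset.sum_sub_distrib, poissonWeight, Complex.ofReal_sum, Finset.mul_sum]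
  refine Finset.sum_congr rfl fun w hw => ?_
  have := one_div_sub_sub_one_div_sub_conj (hs w hw).ne' x
  rw [mul_div_assoc, Complex.ofReal_mul]
  push_cast at this ⊢
  linear_combination (k w : ℂ) * this

theorem poissonWeight_pos (hs : ∀ w ∈ s, 0 < w.im) (hM : 0 < ∑ w ∈ s, k w) (x : ℝ) :
    0 < poissonWeight s k x := by
  obtain ⟨w, hw, hkw⟩ : ∃ w ∈ s, k w ≠ 0 := by
    by_contra! h
    rw [Finset.sum_eq_zero h] at hM
    exact lt_irrefl _ hM
  refine Finset.sum_pos' (fun v hv => ?_) ⟨w, hw, ?_⟩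
  · have := hs v hv
    positivity
  · have h1 := hs w hw
    have h2 : 0 < ‖(x : ℂ) - (starRingEnd ℂ) w‖ :=
      norm_pos_iff.2 (ofReal_sub_ne_zero_of_im_ne_zero (by simpa using h1.ne') x)
    have h3 : (0 : ℝ) < k w := by exact_mod_cast Nat.pos_of_ne_zero hkw
    positivity

/-- The weight decays exactly like `x ^ (-2)`. This determines the summand of the root at infinity.
-/
theorem tendsto_sq_mul_poissonWeight :
    Tendsto (fun x : ℝ => x ^ 2 * poissonWeight s k x) (cocompact ℝ)
      (𝓝 (∑ w ∈ s, (k w : ℝ) * w.im)) := by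
  simp only [poissonWeight, Finset.mul_sum]
  refine tendsto_finsetSum _ fun w _ => ?_
  have h1 := (((tendsto_mul_one_div_sub_pow ((starRingEnd ℂ) w) 1 le_rfl).comp
    tendsto_ofReal_cobounded).norm.pow 2).mul_const ((k w : ℝ) * w.im)
  simp only [if_true, norm_one, one_pow, one_mul, pow_one] at h1
  refine h1.congr fun x => ?_
  simp only [Function.comp_apply, norm_mul, norm_div, norm_one, Complex.norm_real, mul_pow,
    Real.norm_eq_abs, sq_abs, div_pow, one_pow]
  ring

/-! ### The polynomial whose zeros are the nodes -/

/-- The polynomial `q - c p`, whose zeros are the solutions of `q / p = c`. -/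
noncomputable def nodePoly (s : Finset ℂ) (k : ℂ → ℕ) (c : ℂ) : Polynomial ℂ :=
  upperPoly s k - Polynomial.C c * lowerPoly s k

theorem prod_norm_sub_pow_lt_prod {z : ℂ} {v v' : ℂ → ℂ} (hM : 0 < ∑ w ∈ s, k w)
    (h : ∀ w ∈ s, ‖z - v w‖ < ‖z - v' w‖) :
    ∏ w ∈ s, ‖z - v w‖ ^ k w < ∏ w ∈ s, ‖z - v' w‖ ^ k w := by
  obtain ⟨w, hw, hkw⟩ : ∃ w ∈ s, k w ≠ 0 := by
    by_contra! h
    rw [Finset.sum_eq_zero h] at hM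
    exact lt_irrefl _ hM
  classical
  rw [← Finset.mul_prod_erase s _ hw, ← Finset.mul_prod_erase s _ hw]
  refine mul_lt_mul_of_lt_of_le_of_nonneg_of_pos ?_ ?_ (by positivity) ?_
  · exact pow_lt_pow_left₀ (h w hw) (norm_nonneg _) hkw
  · refine Finset.prod_le_prod (fun _ _ => by positivity) fun i hi => ?_
    exact pow_le_pow_left₀ (norm_nonneg _) (h i (Finset.mem_of_mem_erase hi)).le _
  · refine Finset.prod_pos fun i hi => pow_pos ?_ _
    exact (norm_nonneg _).trans_lt (h i (Finset.mem_of_mem_erase hi))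

theorem norm_sub_lt_norm_sub_conj {z w : ℂ} (hz : 0 < z.im) (hw : 0 < w.im) :
    ‖z - w‖ < ‖z - (starRingEnd ℂ) w‖ := by
  rw [← sq_lt_sq₀ (norm_nonneg _) (norm_nonneg _), ← Complex.normSq_eq_norm_sq,
    ← Complex.normSq_eq_norm_sq, Complex.normSq_apply, Complex.normSq_apply]
  simp only [Complex.sub_re, Complex.sub_im, Complex.conj_re, Complex.conj_im]
  nlinarith [mul_pos hz hw]

theorem norm_sub_conj_lt_norm_sub {z w : ℂ} (hz : z.im < 0) (hw : 0 < w.im) :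
    ‖z - (starRingEnd ℂ) w‖ < ‖z - w‖ := by
  have h := norm_sub_lt_norm_sub_conj (z := (starRingEnd ℂ) z) (by simpa using hz) hw
  rwa [← map_sub, Complex.norm_conj, ← Complex.norm_conj, map_sub, Complex.conj_conj] at h

theorem eval_nodePoly (c z : ℂ) : (nodePoly s k c).eval z =
    (upperPoly s k).eval z - c * (lowerPoly s k).eval z := by
  simp [nodePoly]

/-- A point of the upper half-plane is closer to every `w` than to `conj w`, and a point of the
lower half-plane is farther. So `|q| = |p|` fails off the axis. -/
theorem im_eq_zero_of_eval_nodePoly_eq_zero (hs : ∀ w ∈ s, 0 < w.im) (hM : 0 < ∑ w ∈ s, k w)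
    {c : ℂ} (hc : ‖c‖ = 1) {z : ℂ} (hz : (nodePoly s k c).eval z = 0) : z.im = 0 := by
  rw [eval_nodePoly, sub_eq_zero] at hz
  have hn := congrArg norm hz
  rw [norm_mul, hc, one_mul, eval_upperPoly, eval_lowerPoly, norm_prod, norm_prod] at hn
  simp only [norm_pow] at hn
  rcases lt_trichotomy z.im 0 with h | h | h
  · exact absurd hn (prod_norm_sub_pow_lt_prod hM fun w hw =>
      norm_sub_conj_lt_norm_sub h (hs w hw)).ne'
  · exact h
  · exact absurd hn (prod_norm_sub_pow_lt_prod hM fun w hw =>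
      norm_sub_lt_norm_sub_conj h (hs w hw)).ne

/-- Since `q = c * p` at a zero, `N' = q' - c * p' = q * (q' / q - p' / p)`. -/
theorem eval_derivative_nodePoly (hs : ∀ w ∈ s, 0 < w.im) {c : ℂ} {x : ℝ}
    (hx : (nodePoly s k c).eval (x : ℂ) = 0) :
    (nodePoly s k c).derivative.eval (x : ℂ) =
      (upperPoly s k).eval (x : ℂ) * (2 * Complex.I * poissonWeight s k x) := by
  rw [eval_nodePoly, sub_eq_zero] at hx
  have h1 := eval_derivative_prod_X_sub_C_pow s id k (x : ℂ) fun w hw h => by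
    have h0 := hs w hw
    have := congrArg Complex.im h
    rw [Complex.ofReal_im, id_eq] at this
    linarith
  have h2 := eval_derivative_prod_X_sub_C_pow s (starRingEnd ℂ) k (x : ℂ) fun w hw h => by
    have h0 := hs w hw
    have := congrArg Complex.im h
    rw [Complex.ofReal_im, Complex.conj_im] at this
    linarith
  change (upperPoly s k).derivative.eval (x : ℂ) = (upperPoly s k).eval (x : ℂ) * _ at h1
  change (lowerPoly s k).derivative.eval (x : ℂ) = (lowerPoly s k).eval (x : ℂ) * _ at h2
  rw [← sum_div_sub_sub_sum_div_sub_conj hs, nodePoly, Polynomial.derivative_sub,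
    Polynomial.derivative_C_mul, Polynomial.eval_sub, Polynomial.eval_C_mul, h1, h2]
  simp only [id_eq]
  linear_combination (∑ w ∈ s, (k w : ℂ) / ((x : ℂ) - (starRingEnd ℂ) w)) * hx

theorem nodup_roots_nodePoly (hs : ∀ w ∈ s, 0 < w.im) (hM : 0 < ∑ w ∈ s, k w)
    {c : ℂ} (hc : ‖c‖ = 1) : (nodePoly s k c).roots.Nodup := by
  by_cases hN : nodePoly s k c = 0
  · simp [hN]
  rw [Multiset.nodup_iff_count_le_one]
  intro z
  rw [Polynomial.count_roots]
  by_contra! h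
  obtain ⟨h1, h2⟩ := (Polynomial.one_lt_rootMultiplicity_iff_isRoot hN).1 h
  have him := im_eq_zero_of_eval_nodePoly_eq_zero hs hM hc h1
  obtain ⟨x, rfl⟩ : ∃ x : ℝ, (x : ℂ) = z := ⟨z.re, Complex.ext rfl him.symm⟩
  have h3 := eval_derivative_nodePoly hs h1
  rw [h2.eq_zero] at h3
  refine mul_ne_zero (eval_upperPoly_ne_zero hs (by simp)) (mul_ne_zero (by simp) ?_) h3.symm
  exact_mod_cast (poissonWeight_pos hs hM x).ne'

theorem coeff_prod_X_sub_C_pow (v : ℂ → ℂ) (hM : 0 < ∑ w ∈ s, k w) :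
    (∏ w ∈ s, (Polynomial.X - Polynomial.C (v w)) ^ k w).coeff (∑ w ∈ s, k w - 1) =
      -∑ w ∈ s, (k w : ℂ) * v w := by
  have hm : ∀ w ∈ s, ((Polynomial.X - Polynomial.C (v w)) ^ k w).Monic := fun _ _ =>
    (Polynomial.monic_X_sub_C _).pow _
  have hd : (∏ w ∈ s, (Polynomial.X - Polynomial.C (v w)) ^ k w).natDegree = ∑ w ∈ s, k w := by
    rw [Polynomial.natDegree_prod_of_monic _ _ hm]
    simp
  have h1 := Polynomial.nextCoeff_of_natDegree_pos (by rwa [hd])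
  rw [hd] at h1
  rw [← h1, Polynomial.Monic.nextCoeff_prod _ _ hm, ← Finset.sum_neg_distrib]
  refine Finset.sum_congr rfl fun w _ => ?_
  rw [(Polynomial.monic_X_sub_C _).nextCoeff_pow, Polynomial.nextCoeff_X_sub_C]
  simp

theorem coeff_nodePoly (c : ℂ) : (nodePoly s k c).coeff (∑ w ∈ s, k w) = 1 - c := by
  have h1 := (upperPoly_monic (s := s) (k := k)).coeff_natDegree
  have h2 := (lowerPoly_monic (s := s) (k := k)).coeff_natDegree
  rw [natDegree_upperPoly] at h1
  rw [natDegree_lowerPoly] at h2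
  rw [nodePoly, Polynomial.coeff_sub, Polynomial.coeff_C_mul, h1, h2, mul_one]

theorem natDegree_nodePoly_le (c : ℂ) : (nodePoly s k c).natDegree ≤ ∑ w ∈ s, k w :=
  (Polynomial.natDegree_sub_le _ _).trans (max_le natDegree_upperPoly.le
    ((Polynomial.natDegree_C_mul_le _ _).trans natDegree_lowerPoly.le))

theorem natDegree_nodePoly {c : ℂ} (hc : c ≠ 1) :
    (nodePoly s k c).natDegree = ∑ w ∈ s, k w :=
  Polynomial.natDegree_eq_of_le_of_coeff_ne_zero (natDegree_nodePoly_le c)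
    (by rw [coeff_nodePoly]; exact sub_ne_zero.2 hc.symm)

/-- For `c = 1` the top coefficients cancel. By Vieta the next one is the difference of the sums of
zeros of `p` and `q`; it is nonzero, so exactly one root is lost. -/
theorem coeff_nodePoly_one (hM : 0 < ∑ w ∈ s, k w) :
    (nodePoly s k 1).coeff (∑ w ∈ s, k w - 1) =
      -(2 * Complex.I * ((∑ w ∈ s, (k w : ℝ) * w.im : ℝ) : ℂ)) := by
  have h1 := coeff_prod_X_sub_C_pow id hM
  have h2 := coeff_prod_X_sub_C_pow (starRingEnd ℂ) hM
  change (upperPoly s k).coeff _ = _ at h1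
  change (lowerPoly s k).coeff _ = _ at h2
  rw [nodePoly, Polynomial.coeff_sub, Polynomial.coeff_C_mul, h1, h2, one_mul, sub_neg_eq_add,
    ← Finset.sum_neg_distrib, ← Finset.sum_add_distrib, Complex.ofReal_sum, Finset.mul_sum,
    ← Finset.sum_neg_distrib]
  refine Finset.sum_congr rfl fun w _ => ?_
  have h4 : w - (starRingEnd ℂ) w = 2 * w.im * Complex.I := by
    rw [Complex.sub_conj]; push_cast; ring
  push_cast
  rw [id_eq]
  linear_combination (-(k w : ℂ)) * h4

theorem sum_mul_im_pos (hs : ∀ w ∈ s, 0 < w.im) (hM : 0 < ∑ w ∈ s, k w) :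
    0 < ∑ w ∈ s, (k w : ℝ) * w.im := by
  obtain ⟨w, hw, hkw⟩ : ∃ w ∈ s, k w ≠ 0 := by
    by_contra! h
    rw [Finset.sum_eq_zero h] at hM
    exact lt_irrefl _ hM
  refine Finset.sum_pos' (fun v hv => mul_nonneg (Nat.cast_nonneg _) (hs v hv).le)
    ⟨w, hw, mul_pos ?_ (hs w hw)⟩
  exact_mod_cast Nat.pos_of_ne_zero hkw

theorem coeff_nodePoly_one_ne_zero (hs : ∀ w ∈ s, 0 < w.im) (hM : 0 < ∑ w ∈ s, k w) :
    (nodePoly s k 1).coeff (∑ w ∈ s, k w - 1) ≠ 0 := by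
  rw [coeff_nodePoly_one hM]
  have : ((∑ w ∈ s, (k w : ℝ) * w.im : ℝ) : ℂ) ≠ 0 := by
    exact_mod_cast (sum_mul_im_pos hs hM).ne'
  exact neg_ne_zero.2 (mul_ne_zero (by simp) this)

theorem natDegree_nodePoly_one (hs : ∀ w ∈ s, 0 < w.im) (hM : 0 < ∑ w ∈ s, k w) :
    (nodePoly s k 1).natDegree = ∑ w ∈ s, k w - 1 := by
  refine Polynomial.natDegree_eq_of_le_of_coeff_ne_zero ?_ (coeff_nodePoly_one_ne_zero hs hM)
  refine Polynomial.natDegree_le_iff_coeff_eq_zero.2 fun j hj => ?_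
  rcases eq_or_ne j (∑ w ∈ s, k w) with rfl | hne
  · rw [coeff_nodePoly, sub_self]
  · exact Polynomial.coeff_eq_zero_of_natDegree_lt
      ((natDegree_nodePoly_le (s := s) (k := k) 1).trans_lt (by lia))

theorem card_roots_nodePoly (hs : ∀ w ∈ s, 0 < w.im) (hM : 0 < ∑ w ∈ s, k w)
    {c : ℂ} (hc : ‖c‖ = 1) :
    (nodePoly s k c).roots.toFinset.card = (nodePoly s k c).natDegree := by
  rw [Multiset.toFinset_card_of_nodup (nodup_roots_nodePoly hs hM hc)]
  exact IsAlgClosed.card_roots_eq_natDegree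

theorem nodePoly_ne_zero (hs : ∀ w ∈ s, 0 < w.im) (hM : 0 < ∑ w ∈ s, k w) (c : ℂ) :
    nodePoly s k c ≠ 0 := by
  intro h
  rcases eq_or_ne c 1 with rfl | hc
  · exact coeff_nodePoly_one_ne_zero hs hM (by simp [h])
  · have := coeff_nodePoly (s := s) (k := k) c
    rw [h, Polynomial.coeff_zero] at this
    exact sub_ne_zero.2 hc.symm this.symm

/-! ### The quadrature formula -/

/-- At a node `U / q + V / p = (U + c * V) / q`, and division by the weight turns this into `2i * (U
+ c * V) / N'`, ready for Lagrange summation. The degree of `N` is left open to serve both `c ≠ 1`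
and `c = 1`. -/
theorem sum_nodes_mul_leadingCoeff (hs : ∀ w ∈ s, 0 < w.im) (hM : 0 < ∑ w ∈ s, k w)
    {c : ℂ} (hc : ‖c‖ = 1) (U V : Polynomial ℂ)
    (hUV : (U + Polynomial.C c * V).degree < ((nodePoly s k c).natDegree : WithBot ℕ)) :
    (∑ z ∈ (nodePoly s k c).roots.toFinset,
      (U * lowerPoly s k + V * upperPoly s k).eval (z.re : ℂ) /
        (upperPoly s k * lowerPoly s k).eval (z.re : ℂ) / (poissonWeight s k z.re : ℂ)) *
      (nodePoly s k c).leadingCoeff =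
    2 * Complex.I *
      (Polynomial.X * (U + Polynomial.C c * V)).coeff (nodePoly s k c).natDegree := by
  rw [← sum_eval_div_eval_derivative_mul_leadingCoeff _ _ (nodup_roots_nodePoly hs hM hc) hUV,
    ← mul_assoc, Finset.mul_sum]
  congr 1
  refine Finset.sum_congr rfl fun z hz => ?_
  rw [Multiset.mem_toFinset, Polynomial.mem_roots (nodePoly_ne_zero hs hM c)] at hz
  have him := im_eq_zero_of_eval_nodePoly_eq_zero hs hM hc hz
  obtain ⟨x, rfl⟩ : ∃ x : ℝ, (x : ℂ) = z := ⟨z.re, Complex.ext rfl him.symm⟩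
  have hz' := hz.eq_zero
  rw [eval_derivative_nodePoly hs hz, Complex.ofReal_re]
  rw [eval_nodePoly, sub_eq_zero] at hz'
  have hq0 := eval_upperPoly_ne_zero (k := k) hs (z := x) (by simp)
  have hp0 := eval_lowerPoly_ne_zero (k := k) hs (z := x) (by simp)
  have hμ : (poissonWeight s k x : ℂ) ≠ 0 := by
    exact_mod_cast (poissonWeight_pos hs hM x).ne'
  have hI := Complex.I_ne_zero
  simp only [Polynomial.eval_add, Polynomial.eval_mul, Polynomial.eval_C]
  field_simp
  linear_combination (V.eval (x : ℂ)) * hz'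

theorem integral_eq_sum_nodes (hs : ∀ w ∈ s, 0 < w.im) (hM : 0 < ∑ w ∈ s, k w)
    {c : ℂ} (hc : ‖c‖ = 1) (hc1 : c ≠ 1) (F : Polynomial ℂ)
    (hF : F.natDegree < 2 * ∑ w ∈ s, k w)
    (hint : Integrable (fun x : ℝ => F.eval (x : ℂ) /
      (upperPoly s k * lowerPoly s k).eval (x : ℂ))) :
    ∫ x : ℝ, F.eval (x : ℂ) / (upperPoly s k * lowerPoly s k).eval (x : ℂ) =
      Real.pi * ∑ z ∈ (nodePoly s k c).roots.toFinset, F.eval (z.re : ℂ) /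
        (upperPoly s k * lowerPoly s k).eval (z.re : ℂ) / (poissonWeight s k z.re : ℂ) := by
  obtain ⟨U, V, hU, hV, rfl⟩ := exists_bezout_upperPoly_lowerPoly hs hM F hF
  obtain ⟨huv, hI⟩ := integral_eval_div_upperPoly_mul_lowerPoly hs hM hU hV hint
  have hdeg : (U + Polynomial.C c * V).natDegree < ∑ w ∈ s, k w :=
    (Polynomial.natDegree_add_le _ _).trans_lt
      (max_lt hU ((Polynomial.natDegree_C_mul_le _ _).trans_lt hV))
  have h := sum_nodes_mul_leadingCoeff hs hM hc U V (by
    rw [natDegree_nodePoly hc1]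
    exact Polynomial.degree_le_natDegree.trans_lt (by exact_mod_cast hdeg))
  rw [Polynomial.leadingCoeff, natDegree_nodePoly hc1, coeff_nodePoly] at h
  rw [hI]
  obtain ⟨e, he⟩ : ∃ e, ∑ w ∈ s, k w = e + 1 := ⟨∑ w ∈ s, k w - 1, by lia⟩
  rw [he, Nat.add_sub_cancel] at huv ⊢
  rw [he, Polynomial.coeff_X_mul, Polynomial.coeff_add, Polynomial.coeff_C_mul] at h
  have hc1' : 1 - c ≠ 0 := sub_ne_zero.2 hc1.symm
  refine mul_right_cancel₀ hc1' ?_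
  -- The leading coefficient is `1 - c`, and `u + c * v = (1 - c) * u` since `v = -u`.
  rw [mul_assoc, mul_assoc (Real.pi : ℂ), h]
  linear_combination (-2 * Real.pi * Complex.I * c) * huv

theorem exists_tendsto_integral_eq_sum_nodes_add (hs : ∀ w ∈ s, 0 < w.im)
    (hM : 0 < ∑ w ∈ s, k w) (F : Polynomial ℂ) (hF : F.natDegree < 2 * ∑ w ∈ s, k w)
    (hint : Integrable (fun x : ℝ => F.eval (x : ℂ) /
      (upperPoly s k * lowerPoly s k).eval (x : ℂ))) :
    ∃ L : ℂ, Tendsto (fun x : ℝ => F.eval (x : ℂ) /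
      (upperPoly s k * lowerPoly s k).eval (x : ℂ) / (poissonWeight s k x : ℂ))
        (cocompact ℝ) (𝓝 L) ∧
    ∫ x : ℝ, F.eval (x : ℂ) / (upperPoly s k * lowerPoly s k).eval (x : ℂ) =
      Real.pi * (∑ z ∈ (nodePoly s k 1).roots.toFinset, F.eval (z.re : ℂ) /
        (upperPoly s k * lowerPoly s k).eval (z.re : ℂ) / (poissonWeight s k z.re : ℂ) + L) := by
  set σ : ℝ := ∑ w ∈ s, (k w : ℝ) * w.im with hσ
  have hσ0 : (σ : ℂ) ≠ 0 := by exact_mod_cast (sum_mul_im_pos hs hM).ne'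
  set M := ∑ w ∈ s, k w with hMdef
  -- `F / (q * p)` behaves like the coefficient of `F` of order `2 * M - 2` times `x ^ (-2)`, and
  -- the weight like `σ * x ^ (-2)`.
  refine ⟨(Polynomial.X * F).coeff (2 * M - 1) / σ, ?_, ?_⟩
  · have hDm : (upperPoly s k * lowerPoly s k).Monic := upperPoly_monic.mul lowerPoly_monic
    have hDd := natDegree_upperPoly_mul_lowerPoly (s := s) (k := k)
    rw [← hMdef] at hDd
    have hDc := hDm.coeff_natDegree
    rw [hDd] at hDc
    have hF1 := coeff_eq_zero_of_integrable_eval_div _ _ (by rw [hDd]; exact hF) hint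
    rw [hDd] at hF1
    -- Integrability removes the coefficient of `F` of order `2 * M - 1`, so `x ^ 2 * F` has degree
    -- at most `2 * M`.
    have hX : (Polynomial.X * (Polynomial.X * F)).natDegree ≤ 2 * M := by
      refine Polynomial.natDegree_le_iff_coeff_eq_zero.2 fun j hj => ?_
      obtain ⟨i, rfl⟩ : ∃ i, j = i + 2 := ⟨j - 2, by lia⟩
      rw [Polynomial.coeff_X_mul, Polynomial.coeff_X_mul]
      rcases eq_or_ne i (2 * M - 1) with rfl | hne
      · exact hF1
      · exact Polynomial.coeff_eq_zero_of_natDegree_lt (hF.trans_le (by lia))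
    have h1 := (tendsto_eval_div_eval_cobounded _ _ hX hDd.le
      (by rw [hDc]; exact one_ne_zero)).comp tendsto_ofReal_cobounded
    obtain ⟨e, he⟩ : ∃ e, 2 * M = e + 1 := ⟨2 * M - 1, by lia⟩
    rw [hDc, div_one, he, Polynomial.coeff_X_mul] at h1
    rw [he, Nat.add_sub_cancel]
    have h2 := (Complex.continuous_ofReal.tendsto σ).comp
      (tendsto_sq_mul_poissonWeight (s := s) (k := k))
    refine (h1.div h2 hσ0).congr' ?_
    have hne : ∀ᶠ x : ℝ in cocompact ℝ, (x : ℂ) ≠ 0 :=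
      tendsto_ofReal_cobounded.eventually (Bornology.eventually_ne_cobounded 0)
    filter_upwards [hne] with x hx
    have hμ : (poissonWeight s k x : ℂ) ≠ 0 := by
      exact_mod_cast (poissonWeight_pos hs hM x).ne'
    have hD0 := upperPoly_mul_lowerPoly_eval_ne_zero (k := k) hs x
    have hXF : (Polynomial.X * (Polynomial.X * F)).eval (x : ℂ) =
        (x : ℂ) ^ 2 * F.eval (x : ℂ) := by
      rw [Polynomial.eval_mul, Polynomial.eval_mul, Polynomial.eval_X]; ring
    simp only [Pi.div_apply, Function.comp_apply, hXF, Complex.ofReal_mul, Complex.ofReal_pow]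
    field_simp
  · obtain ⟨U, V, hU, hV, rfl⟩ := exists_bezout_upperPoly_lowerPoly hs hM F hF
    obtain ⟨huv, hI⟩ := integral_eval_div_upperPoly_mul_lowerPoly hs hM hU hV hint
    rw [← hMdef] at huv hI
    have hNd := natDegree_nodePoly_one hs hM
    rw [← hMdef] at hNd
    -- `u + v = 0` lowers the degree of `U + V` in step with that of `N`.
    have hWdeg : (U + V).degree < ((M - 1 : ℕ) : WithBot ℕ) := by
      rw [Polynomial.degree_lt_iff_coeff_zero]
      intro j hj
      rcases eq_or_ne j (M - 1) with rfl | hne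
      · rwa [Polynomial.coeff_add]
      · refine Polynomial.coeff_eq_zero_of_natDegree_lt
          ((Polynomial.natDegree_add_le _ _).trans_lt ?_)
        lia
    have h := sum_nodes_mul_leadingCoeff hs hM norm_one U V (by
      rw [hNd, Polynomial.C_1, one_mul]; exact hWdeg)
    rw [Polynomial.leadingCoeff, hNd, hMdef, coeff_nodePoly_one hM, ← hMdef, Polynomial.C_1,
      one_mul, ← hσ] at h
    have hWX : (Polynomial.X * (U + V)).natDegree ≤ M - 1 := by
      refine Polynomial.natDegree_le_iff_coeff_eq_zero.2 fun j hj => ?_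
      obtain ⟨i, rfl⟩ : ∃ i, j = i + 1 := ⟨j - 1, by lia⟩
      rw [Polynomial.coeff_X_mul]
      exact Polynomial.degree_lt_iff_coeff_zero _ _ |>.1 hWdeg i (by lia)
    have hNX : (Polynomial.X * nodePoly s k 1).natDegree ≤ M := by
      refine Polynomial.natDegree_mul_le.trans ?_
      rw [Polynomial.natDegree_X, hNd]
      lia
    have hpc := (lowerPoly_monic (s := s) (k := k)).coeff_natDegree
    rw [natDegree_lowerPoly, ← hMdef] at hpc
    -- With `q = p + N` the numerator becomes `(U + V) * p + V * N`. The second term adds `-2i * σ *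
    -- v`, which is what the limit contributes beyond cancelling the node sum.
    have hcoeff : (Polynomial.X * (U * lowerPoly s k + V * upperPoly s k)).coeff (2 * M - 1) =
        (Polynomial.X * (U + V)).coeff (M - 1) +
          V.coeff (M - 1) * -(2 * Complex.I * (σ : ℂ)) := by
      have h1 : Polynomial.X * (U * lowerPoly s k + V * upperPoly s k) =
          Polynomial.X * (U + V) * lowerPoly s k + V * (Polynomial.X * nodePoly s k 1) := by
        rw [nodePoly, Polynomial.C_1]; ring
      have h2 := Polynomial.coeff_mul_add_eq_of_natDegree_le hWX
        (natDegree_lowerPoly (s := s) (k := k)).le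
      have h3 := Polynomial.coeff_mul_add_eq_of_natDegree_le (Nat.le_sub_one_of_lt hV) hNX
      rw [← hMdef, hpc, mul_one] at h2
      rw [← hMdef] at h3
      have h4 : (Polynomial.X * nodePoly s k 1).coeff M = -(2 * Complex.I * (σ : ℂ)) := by
        rw [hσ, ← coeff_nodePoly_one hM, ← hMdef]
        obtain ⟨e, he⟩ : ∃ e, M = e + 1 := ⟨M - 1, by lia⟩
        rw [he, Polynomial.coeff_X_mul, Nat.add_sub_cancel]
      rw [h1, Polynomial.coeff_add, show 2 * M - 1 = M - 1 + M by lia, h2, h3, h4]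
    rw [hI, hcoeff]
    set S := ∑ z ∈ (nodePoly s k 1).roots.toFinset,
      (U * lowerPoly s k + V * upperPoly s k).eval (z.re : ℂ) /
        (upperPoly s k * lowerPoly s k).eval (z.re : ℂ) / (poissonWeight s k z.re : ℂ)
    have hcW : (Polynomial.X * (U + V)).coeff (M - 1) = -(S * σ) := by
      have hI2 : (2 * Complex.I) ≠ 0 := by simp
      refine mul_left_cancel₀ hI2 ?_
      rw [← h]; ring
    rw [hcW]
    field_simp
    linear_combination (2 * Complex.I) * huv

end ConjugateZeros

/-! ### The denominator of `R_*` -/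

theorem Polynomial.map_conj_map_conj (P : Polynomial ℂ) :
    (P.map (starRingEnd ℂ)).map (starRingEnd ℂ) = P := by
  ext i
  simp

theorem Polynomial.eval_map_conj_ofReal (P : Polynomial ℂ) (x : ℝ) :
    (P.map (starRingEnd ℂ)).eval (x : ℂ) = (starRingEnd ℂ) (P.eval (x : ℂ)) := by
  have h := Polynomial.eval_map_apply (starRingEnd ℂ) (p := P) (x : ℂ)
  rwa [Complex.conj_ofReal] at h

theorem starDenom_map_conj (R : RatFunc ℂ) : (starDenom R).map (starRingEnd ℂ) = starDenom R := by
  rw [starDenom, Polynomial.map_mul, Polynomial.map_conj_map_conj, mul_comm]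

theorem starDenom_monic (R : RatFunc ℂ) : (starDenom R).Monic :=
  R.monic_denom.mul (R.monic_denom.map _)

theorem natDegree_starDenom (R : RatFunc ℂ) :
    (starDenom R).natDegree = 2 * R.denom.natDegree := by
  rw [starDenom, R.monic_denom.natDegree_mul (R.monic_denom.map _), Polynomial.natDegree_map,
    two_mul]

theorem eval_denom_ofReal_ne_zero {R : RatFunc ℂ} (hreal : ∀ x : ℝ, poleOrder R (x : ℂ) = 0)
    (x : ℝ) : R.denom.eval (x : ℂ) ≠ 0 := by
  intro h
  have := hreal x
  rw [poleOrder, Polynomial.rootMultiplicity_eq_zero_iff] at this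
  exact R.denom_ne_zero (this h)

theorem eval_starDenom_ofReal (R : RatFunc ℂ) (x : ℝ) : (starDenom R).eval (x : ℂ) =
    R.denom.eval (x : ℂ) * (starRingEnd ℂ) (R.denom.eval (x : ℂ)) := by
  rw [starDenom, Polynomial.eval_mul, Polynomial.eval_map_conj_ofReal]

theorem eval_starDenom_ofReal_ne_zero {R : RatFunc ℂ}
    (hreal : ∀ x : ℝ, poleOrder R (x : ℂ) = 0) (x : ℝ) : (starDenom R).eval (x : ℂ) ≠ 0 := by
  have h := eval_denom_ofReal_ne_zero hreal x
  rw [eval_starDenom_ofReal]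
  exact mul_ne_zero h ((map_ne_zero _).2 h)

theorem poleMult_conj (R : RatFunc ℂ) (w : ℂ) :
    poleMult R ((starRingEnd ℂ) w) = poleMult R w := by
  have h := Polynomial.eq_rootMultiplicity_map (p := starDenom R) (f := starRingEnd ℂ)
    (starRingEnd ℂ).injective w
  rw [starDenom_map_conj] at h
  exact h.symm

theorem poleMult_pos_iff {R : RatFunc ℂ} {w : ℂ} :
    0 < poleMult R w ↔ w ∈ (starDenom R).roots.toFinset := by
  rw [poleMult, Polynomial.rootMultiplicity_pos (starDenom_monic R).ne_zero,
    Multiset.mem_toFinset, Polynomial.mem_roots (starDenom_monic R).ne_zero]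

theorem mem_upperPoles {R : RatFunc ℂ} {w : ℂ} :
    w ∈ upperPoles R ↔ 0 < poleMult R w ∧ 0 < w.im := by
  rw [poleMult_pos_iff, upperPoles, Finset.mem_filter]

theorem im_pos_of_mem_upperPoles {R : RatFunc ℂ} : ∀ w ∈ upperPoles R, 0 < w.im :=
  fun _ hw => (mem_upperPoles.1 hw).2

/-- The polynomial is invariant under conjugation of coefficients and has no real zero, so its zeros
pair off as `w`, `conj w` with equal multiplicities. -/
theorem starDenom_eq_upperPoly_mul_lowerPoly {R : RatFunc ℂ}
    (hreal : ∀ x : ℝ, poleOrder R (x : ℂ) = 0) :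
    starDenom R = upperPoly (upperPoles R) (poleMult R) *
      lowerPoly (upperPoles R) (poleMult R) := by
  classical
  have hcard : (starDenom R).roots.card = (starDenom R).natDegree :=
    IsAlgClosed.card_roots_eq_natDegree
  have h1 := Polynomial.prod_multiset_X_sub_C_of_monic_of_roots_card_eq (starDenom_monic R) hcard
  rw [Polynomial.prod_multiset_root_eq_finset_root] at h1
  conv_lhs => rw [← h1]
  rw [← Finset.prod_filter_mul_prod_filter_not (starDenom R).roots.toFinset
    (fun w : ℂ => 0 < w.im)]
  congr 1
  · rw [lowerPoly]
    refine Finset.prod_nbij' (starRingEnd ℂ) (starRingEnd ℂ) (fun w hw => ?_) (fun w hw => ?_)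
      (fun w _ => Complex.conj_conj w) (fun w _ => Complex.conj_conj w) (fun w _ => ?_)
    · rw [Finset.mem_filter] at hw
      rw [mem_upperPoles, poleMult_conj, poleMult_pos_iff]
      refine ⟨hw.1, ?_⟩
      rw [Complex.conj_im, neg_pos]
      refine lt_of_le_of_ne (not_lt.1 hw.2) fun h => ?_
      have hroot := hw.1
      rw [Multiset.mem_toFinset, Polynomial.mem_roots (starDenom_monic R).ne_zero] at hroot
      refine eval_starDenom_ofReal_ne_zero hreal w.re ?_
      rwa [show ((w.re : ℝ) : ℂ) = w from Complex.ext rfl h.symm]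
    · rw [mem_upperPoles] at hw
      rw [Finset.mem_filter, ← poleMult_pos_iff, poleMult_conj]
      refine ⟨hw.1, ?_⟩
      rw [Complex.conj_im]
      linarith [hw.2]
    · change _ ^ poleMult R w = _
      rw [Complex.conj_conj, poleMult_conj]

theorem sum_poleMult_upperPoles {R : RatFunc ℂ} (hreal : ∀ x : ℝ, poleOrder R (x : ℂ) = 0) :
    ∑ w ∈ upperPoles R, poleMult R w = R.denom.natDegree := by
  have h := congrArg Polynomial.natDegree (starDenom_eq_upperPoly_mul_lowerPoly hreal)
  rw [natDegree_upperPoly_mul_lowerPoly, natDegree_starDenom] at h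
  lia

theorem poleOrder_starRat_le (R : RatFunc ℂ) (w : ℂ) : poleOrder (starRat R) w ≤ poleMult R w := by
  refine Polynomial.rootMultiplicity_le_rootMultiplicity_of_dvd (starDenom_monic R).ne_zero ?_ _
  exact (RatFunc.denom_mul_dvd _ _).trans (mul_dvd_mul_left _ (RatFunc.denom_div_dvd _ _))

theorem poleOrder_starRat_eq (R : RatFunc ℂ)
    (h : ∑ w ∈ upperPoles R, poleOrder (starRat R) w = ∑ w ∈ upperPoles R, poleMult R w)
    (w : ℂ) (hw : 0 < w.im) : poleOrder (starRat R) w = poleMult R w := by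
  by_cases hmem : w ∈ upperPoles R
  -- Cancellation can only lower multiplicities, so equal sums force termwise equality.
  · exact (Finset.sum_eq_sum_iff_of_le fun v _ => poleOrder_starRat_le R v).1 h w hmem
  · have h0 : poleMult R w = 0 := by
      by_contra h0
      exact hmem (mem_upperPoles.2 ⟨Nat.pos_of_ne_zero h0, hw⟩)
    exact le_antisymm (poleOrder_starRat_le R w) (by rw [h0]; exact Nat.zero_le _)

/-! ### Powers -/

theorem upperPoly_mul_eq_pow (s : Finset ℂ) (k : ℂ → ℕ) (m : ℕ) :
    upperPoly s (fun w => m * k w) = upperPoly s k ^ m := by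
  simp only [upperPoly, ← Finset.prod_pow, ← pow_mul, mul_comm m]

theorem lowerPoly_mul_eq_pow (s : Finset ℂ) (k : ℂ → ℕ) (m : ℕ) :
    lowerPoly s (fun w => m * k w) = lowerPoly s k ^ m := by
  simp only [lowerPoly, ← Finset.prod_pow, ← pow_mul, mul_comm m]

/-- The source of the factor `1 / m` in the formulas. -/
theorem poissonWeight_mul (R : RatFunc ℂ) (m : ℕ) (x : ℝ) :
    poissonWeight (upperPoles R) (fun w => m * poleMult R w) x = m * muStar R x := by
  rw [poissonWeight, muStar, Finset.mul_sum]
  refine Finset.sum_congr rfl fun w _ => ?_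
  push_cast
  ring

theorem starDenom_pow_eq {R : RatFunc ℂ} (hreal : ∀ x : ℝ, poleOrder R (x : ℂ) = 0) (m : ℕ) :
    starDenom R ^ m = upperPoly (upperPoles R) (fun w => m * poleMult R w) *
      lowerPoly (upperPoles R) (fun w => m * poleMult R w) := by
  rw [upperPoly_mul_eq_pow, lowerPoly_mul_eq_pow, ← mul_pow,
    ← starDenom_eq_upperPoly_mul_lowerPoly hreal]

theorem blaschkeStar_eq_div (R : RatFunc ℂ) (z : ℂ) :
    blaschkeStar R z = (upperPoly (upperPoles R) (poleMult R)).eval z /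
      (lowerPoly (upperPoles R) (poleMult R)).eval z := by
  rw [blaschkeStar, eval_upperPoly, eval_lowerPoly, ← Finset.prod_div_distrib]
  exact Finset.prod_congr rfl fun w _ => div_pow _ _ _

theorem isNotch_iff (R : RatFunc ℂ) {m : ℕ} (hm : 1 ≤ m) (φ : ℝ) (z : ℂ) :
    IsNotch R m φ z ↔ (nodePoly (upperPoles R) (fun w => m * poleMult R w)
      (Complex.exp (Complex.I * φ))).eval z = 0 := by
  have hm0 : m ≠ 0 := by lia
  rw [IsNotch, blaschkeStar_eq_div, eval_nodePoly, upperPoly_mul_eq_pow, lowerPoly_mul_eq_pow,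
    Polynomial.eval_pow, Polynomial.eval_pow, sub_eq_zero, div_pow]
  -- At a zero of `p` the quotient has the default value `0`, which is no exponential. Such a point
  -- lies in the lower half-plane, where `q ≠ 0`, so it is no zero of `N` either.
  by_cases hp : (lowerPoly (upperPoles R) (poleMult R)).eval z = 0
  · have hz : z.im < 0 := by
      by_contra h
      exact eval_lowerPoly_ne_zero im_pos_of_mem_upperPoles (not_lt.1 h) hp
    have hq := eval_upperPoly_ne_zero (k := poleMult R) (s := upperPoles R)
      im_pos_of_mem_upperPoles hz.le
    rw [hp, zero_pow hm0, div_zero, mul_zero]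
    exact ⟨fun h => absurd h.symm (Complex.exp_ne_zero _), fun h => absurd h (pow_ne_zero _ hq)⟩
  · rw [div_eq_iff (pow_ne_zero _ hp)]

theorem tendsto_blaschkeStar_pow (R : RatFunc ℂ) (m : ℕ) :
    Tendsto (fun z : ℂ => blaschkeStar R z ^ m) (cocompact ℂ) (𝓝 1) := by
  rw [← Metric.cobounded_eq_cocompact]
  have hq := (upperPoly_monic (s := upperPoles R) (k := poleMult R)).coeff_natDegree
  have hp := (lowerPoly_monic (s := upperPoles R) (k := poleMult R)).coeff_natDegree
  rw [natDegree_upperPoly] at hq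
  rw [natDegree_lowerPoly] at hp
  have h := (tendsto_eval_div_eval_cobounded _ _ natDegree_upperPoly.le
    (natDegree_lowerPoly (s := upperPoles R) (k := poleMult R)).le
    (by rw [hp]; exact one_ne_zero)).pow m
  rw [hq, hp, div_one, one_pow] at h
  exact h.congr fun z => by rw [blaschkeStar_eq_div]

theorem exists_fin_enumeration_roots (N : Polynomial ℂ) (hN : N ≠ 0)
    (him : ∀ z, N.eval z = 0 → z.im = 0) {d : ℕ} (hd : N.roots.toFinset.card = d) :
    ∃ x : Fin d → ℝ, Function.Injective x ∧ (∀ z : ℂ, N.eval z = 0 ↔ ∃ i, z = (x i : ℂ)) ∧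
      ∀ {E : Type} [AddCommMonoid E] (f : ℝ → E),
        ∑ z ∈ N.roots.toFinset, f z.re = ∑ i, f (x i) := by
  have hmem : ∀ z, z ∈ N.roots.toFinset ↔ N.eval z = 0 := fun z => by
    rw [Multiset.mem_toFinset, Polynomial.mem_roots hN, Polynomial.IsRoot.def]
  set e := N.roots.toFinset.equivFinOfCardEq hd
  have hre : ∀ i, (((e.symm i : ℂ).re : ℝ) : ℂ) = e.symm i := fun i =>
    Complex.ext rfl (him _ ((hmem _).1 (e.symm i).2)).symm
  refine ⟨fun i => (e.symm i : ℂ).re, fun i j hij => ?_, fun z => ⟨fun hz => ?_, ?_⟩,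
    fun f => ?_⟩
  · have h : ((e.symm i : ℂ)) = e.symm j := by rw [← hre i, ← hre j]; exact congrArg _ hij
    exact e.symm.injective (Subtype.ext h)
  · exact ⟨e ⟨z, (hmem z).2 hz⟩, by rw [hre]; simp⟩
  · rintro ⟨i, rfl⟩
    rw [hre]
    exact (hmem _).1 (e.symm i).2
  · rw [← Finset.sum_coe_sort, ← e.symm.sum_comp]

/-! ### Values of `R` on the real line -/

theorem ratValue_eq (R : RatFunc ℂ) (z : ℂ) :
    ratValue R z = R.num.eval z / R.denom.eval z := rfl

/-- Expanding the fraction by the conjugate denominator gives `R ^ m` the same denominator as `|R| ^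
(2 * m)`. -/
theorem ratValue_pow_eq {R : RatFunc ℂ} (hreal : ∀ x : ℝ, poleOrder R (x : ℂ) = 0) (m : ℕ)
    (x : ℝ) : ratValue R x ^ m =
      ((R.num * R.denom.map (starRingEnd ℂ)) ^ m).eval (x : ℂ) / (starDenom R ^ m).eval (x : ℂ) := by
  have h := eval_denom_ofReal_ne_zero hreal x
  rw [Polynomial.eval_pow, Polynomial.eval_pow, ← div_pow, eval_starDenom_ofReal,
    Polynomial.eval_mul, Polynomial.eval_map_conj_ofReal,
    mul_div_mul_right _ _ ((map_ne_zero _).2 h), ratValue_eq]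

theorem norm_ratValue_pow_eq (R : RatFunc ℂ) (m : ℕ)
    (x : ℝ) : ((‖ratValue R x‖ ^ (2 * m) : ℝ) : ℂ) =
      ((R.num * R.num.map (starRingEnd ℂ)) ^ m).eval (x : ℂ) / (starDenom R ^ m).eval (x : ℂ) := by
  rw [Polynomial.eval_pow, Polynomial.eval_pow, ← div_pow, eval_starDenom_ofReal,
    Polynomial.eval_mul, Polynomial.eval_map_conj_ofReal, pow_mul, Complex.ofReal_pow]
  congr 1
  rw [Complex.mul_conj', Complex.mul_conj', ratValue_eq, norm_div]
  push_cast
  rw [div_pow]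

/-! ### Quadrature with the denominator of `R_* ^ m` -/

theorem sum_mul_poleMult {R : RatFunc ℂ} (hreal : ∀ x : ℝ, poleOrder R (x : ℂ) = 0) (m : ℕ) :
    ∑ w ∈ upperPoles R, m * poleMult R w = m * R.denom.natDegree := by
  rw [← Finset.mul_sum, sum_poleMult_upperPoles hreal]

theorem sum_div_poissonWeight_mul (R : RatFunc ℂ) (m : ℕ) (T : Finset ℂ) (g : ℝ → ℂ) :
    ∑ z ∈ T, g z.re / (poissonWeight (upperPoles R) (fun w => m * poleMult R w) z.re : ℂ) =
      (∑ z ∈ T, g z.re / (muStar R z.re : ℂ)) / m := by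
  rw [Finset.sum_div]
  refine Finset.sum_congr rfl fun z _ => ?_
  rw [poissonWeight_mul]
  push_cast
  rw [mul_comm, div_div]

theorem integral_eq_sum_nodes_div_muStar {R : RatFunc ℂ}
    (hreal : ∀ x : ℝ, poleOrder R (x : ℂ) = 0) {m : ℕ} (hM : 0 < m * R.denom.natDegree)
    {c : ℂ} (hc : ‖c‖ = 1) (hc1 : c ≠ 1) {F : Polynomial ℂ}
    (hF : F.natDegree < 2 * (m * R.denom.natDegree)) {g : ℝ → ℂ}
    (hg : ∀ x : ℝ, g x = F.eval (x : ℂ) / (starDenom R ^ m).eval (x : ℂ)) (hint : Integrable g) :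
    ∫ x, g x = (Real.pi / m : ℂ) * ∑ z ∈ (nodePoly (upperPoles R)
      (fun w => m * poleMult R w) c).roots.toFinset, g z.re / (muStar R z.re : ℂ) := by
  have hsum := sum_mul_poleMult hreal m
  have h := integral_eq_sum_nodes (k := fun w => m * poleMult R w) im_pos_of_mem_upperPoles
    (by rwa [hsum]) hc hc1 F (by rwa [hsum])
  simp only [← starDenom_pow_eq hreal, ← hg] at h
  rw [h hint, sum_div_poissonWeight_mul]
  ring

theorem exists_tendsto_integral_eq_sum_nodes_div_muStar_add {R : RatFunc ℂ}
    (hreal : ∀ x : ℝ, poleOrder R (x : ℂ) = 0) {m : ℕ} (hM : 0 < m * R.denom.natDegree)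
    {F : Polynomial ℂ}
    (hF : F.natDegree < 2 * (m * R.denom.natDegree)) {g : ℝ → ℂ}
    (hg : ∀ x : ℝ, g x = F.eval (x : ℂ) / (starDenom R ^ m).eval (x : ℂ)) (hint : Integrable g) :
    ∃ L : ℂ, Tendsto (fun x : ℝ => g x / (muStar R x : ℂ)) (cocompact ℝ) (𝓝 L) ∧
      ∫ x, g x = (Real.pi / m : ℂ) * (∑ z ∈ (nodePoly (upperPoles R)
        (fun w => m * poleMult R w) 1).roots.toFinset, g z.re / (muStar R z.re : ℂ) + L) := by
  have hm0 : (m : ℂ) ≠ 0 := by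
    have : m ≠ 0 := by rintro rfl; simp at hM
    exact_mod_cast this
  have hsum := sum_mul_poleMult hreal m
  obtain ⟨L, hL, h⟩ := exists_tendsto_integral_eq_sum_nodes_add
    (k := fun w => m * poleMult R w) im_pos_of_mem_upperPoles
    (by rwa [hsum]) F (by rwa [hsum]) (by simpa only [← starDenom_pow_eq hreal, ← hg] using hint)
  simp only [← starDenom_pow_eq hreal, ← hg] at h hL
  refine ⟨m * L, (hL.const_mul (m : ℂ)).congr fun x => ?_, ?_⟩
  · rw [poissonWeight_mul, Complex.ofReal_mul, Complex.ofReal_natCast, ← mul_div_assoc,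
      mul_div_mul_left _ _ hm0]
  · rw [h, sum_div_poissonWeight_mul]
    field_simp

/-! ### The theorem for `R` -/

theorem exp_I_mul_eq_one_iff (φ : ℝ) :
    Complex.exp (Complex.I * φ) = 1 ↔ ∃ j : ℤ, φ = 2 * Real.pi * j := by
  rw [Complex.exp_eq_one_iff]
  refine exists_congr fun j => ?_
  rw [show (j : ℂ) * (2 * Real.pi * Complex.I) = Complex.I * ((2 * Real.pi * j : ℝ) : ℂ) by
    push_cast; ring, mul_right_inj' Complex.I_ne_zero, Complex.ofReal_inj]

theorem mainTheorem2 (R : RatFunc ℂ) (n : ℕ) (hn : 1 ≤ n) (hdeg : ratDegree R = n)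
    (hproper : IsProperRat R) (hreal : ∀ x : ℝ, poleOrder R (x : ℂ) = 0)
    (m : ℕ) (hm : 1 ≤ m) (φ : ℝ) :
    -- the multiplicities sum to `n`
    (∑ w ∈ upperPoles R, poleMult R w = n) ∧
    -- they are the pole multiplicities of `R_*` in lowest terms, if those sum to `n`
    ((∑ w ∈ upperPoles R, poleOrder (starRat R) w = n) →
      ∀ w : ℂ, 0 < w.im → poleOrder (starRat R) w = poleMult R w) ∧
    -- `φ ≢ 0 (mod 2π)`: there are `m n` distinct notches, all finite and real
    ((¬ ∃ j : ℤ, φ = 2 * Real.pi * j) →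
      ∃ x : Fin (m * n) → ℝ, Function.Injective x ∧
        (∀ z : ℂ, IsNotch R m φ z ↔ ∃ k, z = (x k : ℂ)) ∧
        (Integrable (fun t : ℝ => ratValue R t ^ m) →
          ∫ t : ℝ, ratValue R t ^ m =
            (Real.pi / m : ℂ) * ∑ k, ratValue R (x k) ^ m / (muStar R (x k) : ℂ)) ∧
        Integrable (fun t : ℝ => ‖ratValue R t‖ ^ (2 * m)) ∧
        ∫ t : ℝ, ‖ratValue R t‖ ^ (2 * m) =
          (Real.pi / m) * ∑ k, ‖ratValue R (x k)‖ ^ (2 * m) / muStar R (x k)) ∧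
    -- `φ ≡ 0 (mod 2π)`: one of the `m n` notches is at infinity, the others are distinct and real;
    -- the summand of the notch at infinity is the limit of the summand
    ((∃ j : ℤ, φ = 2 * Real.pi * j) →
      Tendsto (fun z : ℂ => blaschkeStar R z ^ m) (cocompact ℂ)
        (𝓝 (Complex.exp (Complex.I * φ))) ∧
      ∃ x : Fin (m * n - 1) → ℝ, Function.Injective x ∧
        (∀ z : ℂ, IsNotch R m φ z ↔ ∃ k, z = (x k : ℂ)) ∧
        (Integrable (fun t : ℝ => ratValue R t ^ m) →
          ∃ L : ℂ,
            Tendsto (fun t : ℝ => ratValue R t ^ m / (muStar R t : ℂ)) (cocompact ℝ) (𝓝 L) ∧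
            ∫ t : ℝ, ratValue R t ^ m =
              (Real.pi / m : ℂ) *
                ((∑ k, ratValue R (x k) ^ m / (muStar R (x k) : ℂ)) + L)) ∧
        Integrable (fun t : ℝ => ‖ratValue R t‖ ^ (2 * m)) ∧
        ∃ L : ℝ,
          Tendsto (fun t : ℝ => ‖ratValue R t‖ ^ (2 * m) / muStar R t) (cocompact ℝ) (𝓝 L) ∧
          ∫ t : ℝ, ‖ratValue R t‖ ^ (2 * m) =
            (Real.pi / m) *
              ((∑ k, ‖ratValue R (x k)‖ ^ (2 * m) / muStar R (x k)) + L)) := by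
  have hnum : R.num.natDegree < R.denom.natDegree ∧ R.denom.natDegree = n := by
    rw [ratDegree] at hdeg
    rw [IsProperRat] at hproper
    by_cases h0 : R.num = 0
    · rw [h0, Polynomial.natDegree_zero] at hdeg ⊢
      lia
    · have := Polynomial.natDegree_lt_natDegree h0 hproper
      lia
  obtain ⟨hnumlt, hden⟩ := hnum
  have hsumn : ∑ w ∈ upperPoles R, poleMult R w = n := (sum_poleMult_upperPoles hreal).trans hden
  have hMpos : 0 < m * n := Nat.mul_pos hm hn
  have hM : 0 < m * R.denom.natDegree := by rwa [hden]
  have hsum : ∑ w ∈ upperPoles R, m * poleMult R w = m * n := by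
    rw [sum_mul_poleMult hreal, hden]
  have hM' : 0 < ∑ w ∈ upperPoles R, m * poleMult R w := by rwa [hsum]
  have hs := im_pos_of_mem_upperPoles (R := R)
  have hF₁ : ((R.num * R.denom.map (starRingEnd ℂ)) ^ m).natDegree <
      2 * (m * R.denom.natDegree) := by
    refine Polynomial.natDegree_pow_le.trans_lt ?_
    rw [mul_left_comm]
    refine Nat.mul_lt_mul_of_pos_left (Polynomial.natDegree_mul_le.trans_lt ?_) hm
    rw [Polynomial.natDegree_map]
    lia
  -- Properness counts twice, in `R` and in its conjugate; the drop of two in degree makes `|R| ^ (2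
  -- * m)` integrable unconditionally.
  have hF₂' : ((R.num * R.num.map (starRingEnd ℂ)) ^ m).natDegree + 2 ≤
      2 * (m * R.denom.natDegree) := by
    have h1 : (R.num * R.num.map (starRingEnd ℂ)).natDegree + 2 ≤ 2 * R.denom.natDegree := by
      have := Polynomial.natDegree_mul_le (p := R.num) (q := R.num.map (starRingEnd ℂ))
      rw [Polynomial.natDegree_map] at this
      lia
    have h2 := Polynomial.natDegree_pow_le (p := R.num * R.num.map (starRingEnd ℂ)) (n := m)
    nlinarith
  have hint₂ : Integrable (fun t : ℝ => ((‖ratValue R t‖ ^ (2 * m) : ℝ) : ℂ)) := by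
    simp only [norm_ratValue_pow_eq]
    refine integrable_eval_div_of_natDegree_add_two_le _ _ (fun x => ?_) ?_
    · rw [Polynomial.eval_pow]
      exact pow_ne_zero _ (eval_starDenom_ofReal_ne_zero hreal x)
    · rw [(starDenom_monic R).natDegree_pow, natDegree_starDenom]
      lia
  have hintR : Integrable (fun t : ℝ => ‖ratValue R t‖ ^ (2 * m)) := hint₂.re
  have hc : ‖Complex.exp (Complex.I * φ)‖ = 1 := by
    rw [mul_comm]; exact Complex.norm_exp_ofReal_mul_I φ
  refine ⟨hsumn, fun h => poleOrder_starRat_eq R (h.trans hsumn.symm), fun hφ => ?_, fun hφ => ?_⟩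
  · have hc1 : Complex.exp (Complex.I * φ) ≠ 1 := fun h => hφ ((exp_I_mul_eq_one_iff φ).1 h)
    obtain ⟨x, hinj, hx, hxsum⟩ := exists_fin_enumeration_roots _
      (nodePoly_ne_zero hs hM' (Complex.exp (Complex.I * φ)))
      (fun z hz => im_eq_zero_of_eval_nodePoly_eq_zero hs hM' hc hz)
      ((card_roots_nodePoly hs hM' hc).trans ((natDegree_nodePoly hc1).trans hsum))
    refine ⟨x, hinj, fun z => (isNotch_iff R hm φ z).trans (hx z), fun hint => ?_, hintR, ?_⟩
    · rw [integral_eq_sum_nodes_div_muStar hreal hM hc hc1 hF₁ (ratValue_pow_eq hreal m) hint,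
        hxsum fun t => ratValue R t ^ m / (muStar R t : ℂ)]
    · have h := integral_eq_sum_nodes_div_muStar hreal hM hc hc1 (by lia)
        (norm_ratValue_pow_eq R m) hint₂
      rw [hxsum fun t => ((‖ratValue R t‖ ^ (2 * m) : ℝ) : ℂ) / (muStar R t : ℂ),
        integral_complex_ofReal] at h
      exact_mod_cast h
  · have hc1 : Complex.exp (Complex.I * φ) = 1 := (exp_I_mul_eq_one_iff φ).2 hφ
    rw [hc1]
    obtain ⟨x, hinj, hx, hxsum⟩ := exists_fin_enumeration_roots _
      (nodePoly_ne_zero hs hM' 1)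
      (fun z hz => im_eq_zero_of_eval_nodePoly_eq_zero hs hM' norm_one hz)
      ((card_roots_nodePoly hs hM' norm_one).trans
        ((natDegree_nodePoly_one hs hM').trans (by rw [hsum])))
    refine ⟨tendsto_blaschkeStar_pow R m, x, hinj, fun z => ?_, fun hint => ?_, hintR, ?_⟩
    · rw [isNotch_iff R hm φ z, hc1]
      exact hx z
    · obtain ⟨L, hL, h⟩ := exists_tendsto_integral_eq_sum_nodes_div_muStar_add hreal hM hF₁
        (ratValue_pow_eq hreal m) hint
      exact ⟨L, hL, by rw [h, hxsum fun t => ratValue R t ^ m / (muStar R t : ℂ)]⟩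
    · obtain ⟨L, hL, h⟩ := exists_tendsto_integral_eq_sum_nodes_div_muStar_add hreal hM
        (by lia) (norm_ratValue_pow_eq R m) hint₂
      have hLre : Tendsto (fun t : ℝ => ‖ratValue R t‖ ^ (2 * m) / muStar R t)
          (cocompact ℝ) (𝓝 L.re) := by
        refine ((Complex.continuous_re.tendsto L).comp hL).congr fun t => ?_
        rw [Function.comp_apply, ← Complex.ofReal_div, Complex.ofReal_re]
      -- The summands are real, hence so is their limit.
      have hLeq : L = (L.re : ℂ) := by
        refine tendsto_nhds_unique hL (((Complex.continuous_ofReal.tendsto _).comp hLre).congr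
          fun t => ?_)
        rw [Function.comp_apply, Complex.ofReal_div]
      refine ⟨L.re, hLre, ?_⟩
      rw [hxsum fun t => ((‖ratValue R t‖ ^ (2 * m) : ℝ) : ℂ) / (muStar R t : ℂ),
        integral_complex_ofReal, hLeq] at h
      exact_mod_cast h
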